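/- Let $G$ be a finite simple connected graph with vertex set $V$, $|V|\ge 2$, and let $d(u,v)$ be the number of edges of a shortest path between $u$ and $v$. For two distinct vertices $u,v$, the line $\overline{uv}$ is the set of all vertices $z$ such that $u,v,z$ are collinear, i.e. $d(u,v)=d(u,z)+d(z,v)$ or $d(u,z)=d(u,v)+d(v,z)$ or $d(v,z)=d(v,u)+d(u,z)$; a line is universal if it equals $V$. The house is the graph on five vertices obtained from a 5-cycle by adding one chord, and a hole is a cycle on at least five vertices. Theorem. If $G$ contains neither the house nor a hole as an induced subgraph, then the graph metric of $G$ satisfies the de Bruijn–Erdős property: it has a universal line, or it has at least $|V|$ distinct lines. Moreover, the same holds when only lines generated by two distinct vertices at distance at most $2$ are considered: either some line $\overline{uv}$ with $u\ne v$ and $d(u,v)\le 2$ is universal, or there are at least $|V|$ distinct lines $\overline{uv}$ with $u\neq v$ and $d(u,v)\le 2$. -/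

import Mathlib

namespace SimpleGraph

variable {V : Type*}

/-- The vertex `z` is between `u` and `v` in the graph metric. -/
def IsBetween (G : SimpleGraph V) (u v z : V) : Prop :=
  G.dist u v = G.dist u z + G.dist z v

/-- Three vertices are collinear if one of them is between the two others. -/
def AreCollinear (G : SimpleGraph V) (u v z : V) : Prop :=
  G.IsBetween u v z ∨ G.IsBetween u z v ∨ G.IsBetween v z u

/-- The line defined by `u` and `v`: all vertices `z` such that `u`, `v`, `z` are collinear. -/
def metricLine (G : SimpleGraph V) (u v : V) : Set V :=
  {z | G.AreCollinear u v z}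

/-- The set of all lines of the graph metric of `G`. A line is defined by two distinct points. -/
def metricLines (G : SimpleGraph V) : Set (Set V) :=
  {L | ∃ u v : V, u ≠ v ∧ L = G.metricLine u v}

/-- The set of all lines defined by two distinct vertices at distance at most 2. -/
def shortLines (G : SimpleGraph V) : Set (Set V) :=
  {L | ∃ u v : V, u ≠ v ∧ G.dist u v ≤ 2 ∧ L = G.metricLine u v}

/-- The de Bruijn–Erdős property of the graph metric of `G`: there is a universal line, or there
are at least `|V|` distinct lines. -/
def DeBruijnErdos (G : SimpleGraph V) : Prop :=
  Set.univ ∈ G.metricLines ∨ Nat.card V ≤ G.metricLines.ncard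

/-- The strengthening of the de Bruijn–Erdős property in which only lines defined by two distinct
vertices at distance at most 2 are considered. -/
def DeBruijnErdosTwo (G : SimpleGraph V) : Prop :=
  Set.univ ∈ G.shortLines ∨ Nat.card V ≤ G.shortLines.ncard

/-- The house: a 5-cycle with one chord added. -/
def house : SimpleGraph (Fin 5) :=
  cycleGraph 5 ⊔ edge 0 2

/-- `G` has no induced house and no hole, that is, no induced cycle on at least 5 vertices. -/
def IsHouseHoleFree (G : SimpleGraph V) : Prop :=
  ¬ house.IsIndContained G ∧ ∀ k : ℕ, 5 ≤ k → ¬ (cycleGraph k).IsIndContained G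

end SimpleGraph

namespace SimpleGraph

/-! ### Forbidden induced subgraphs and the metric conditions they force -/

variable {V : Type*} {G : SimpleGraph V}

/-! The hypothesis is used mainly through two conditions on distances from a fixed vertex z.
Triangle condition (`exists_adj_adj_of_triangle`): adjacent vertices equidistant from z, and
different from z, have a common neighbour one step nearer to z. Quadrangle condition
(`exists_adj_adj_of_quadrangle`): two nonadjacent vertices at distance k + 1 with a common neighbour
at distance k + 2 have another at distance k. A vertex is off the line of an edge exactly when it is
equidistant from the ends, so an edge in no triangle has a universal line. Hence every edge may be
assumed to lie in a triangle.

Suppose first that there are no false twins. The lines counted come from edges and from parity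
twins, and no line is of both kinds (`ParityTwins.metricLine_ne_of_adj`). Two edges with the same
line have ends that coincide up to parity twins (`IsTriangleFull.edgeMatch_of_metricLine_eq`). So
one edge per edge line, together with all pairs of parity twins, forms a connected graph on V, which
has at least |V| - 1 edges. If distinct pairs of twins have distinct lines, this gives |V| - 1
lines; the missing one is gained because one side of a triangle can be dropped, its ends being
joined through the apex.

Pairs of twins that share their line (repeated pairs) would be overcounted. Each is assigned a base
edge inside its common neighbourhood. The chosen edges for base lines can all be dropped, since the
other two sides of suitable triangles have lines that are not base lines. Repeated pairs with the
same base line can be exchanged for one another along a pair that is not repeated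
(`IsTriangleFull.splitBy_of_common_adj`), so one repeated pair per base line is enough. Gain and
cost cancel, and the line of a repeated pair supplies the missing unit.

False twins are handled by passing to one representative per class: if no short line is universal,
each discarded vertex w has a short line that singles it out in its class, and these lines are new.
-/

theorem cycleGraph_adj_of_lt {n : ℕ} {i j : Fin n} (hij : i < j) :
    (cycleGraph n).Adj i j ↔ j.val = i.val + 1 ∨ (i.val = 0 ∧ j.val + 1 = n) := by
  have h1 : (j - i).val = j.val - i.val := Fin.sub_val_of_le hij.le
  have h2 : (i - j).val = n + i.val - j.val := Fin.coe_sub_iff_lt.2 hij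
  have hi := i.isLt
  have hj := j.isLt
  have hij' : i.val < j.val := hij
  rw [cycleGraph_adj', h1, h2]
  omega

/-- A function on `Fin n` inducing a cycle yields an induced copy of `cycleGraph n`. -/
theorem isIndContained_of_lt {n : ℕ} {H : SimpleGraph (Fin n)} (f : Fin n → V)
    (hne : ∀ i j, i < j → f i ≠ f j) (hadj : ∀ i j, i < j → (G.Adj (f i) (f j) ↔ H.Adj i j)) :
    H.IsIndContained G := by
  refine ⟨⟨⟨f, ?_⟩, ?_⟩⟩
  · intro i j h
    rcases lt_trichotomy i j with h1 | h1 | h1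
    · exact absurd h (hne i j h1)
    · exact h1
    · exact absurd h.symm (hne j i h1)
  · intro i j
    change G.Adj (f i) (f j) ↔ H.Adj i j
    rcases lt_trichotomy i j with h1 | h1 | h1
    · exact hadj i j h1
    · subst h1
      simp
    · rw [G.adj_comm, H.adj_comm]
      exact hadj j i h1

/-- A hole-free graph has no induced path on at least four vertices whose ends are the only
neighbours on the path of some further vertex. -/
theorem not_induced_path_with_apex (hhole : ∀ k : ℕ, 5 ≤ k → ¬ (cycleGraph k).IsIndContained G)
    {m : ℕ} (hm : 3 ≤ m) (p : ℕ → V) (w : V)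
    (hstep : ∀ i, i < m → G.Adj (p i) (p (i + 1)))
    (hind : ∀ i j, i + 1 < j → j ≤ m → p i ≠ p j ∧ ¬ G.Adj (p i) (p j))
    (h0 : G.Adj w (p 0)) (hl : G.Adj w (p m)) (hmid : ∀ i, 0 < i → i < m → ¬ G.Adj w (p i)) :
    False := by
  have hw : ∀ i, i ≤ m → p i ≠ w := by
    rintro i hi rfl
    rcases Nat.eq_zero_or_pos i with h | h
    · subst h; exact G.loopless.irrefl _ h0
    rcases hi.lt_or_eq with h' | h'
    · have h1 : ¬ 0 + 1 < i := fun h1 => (hind 0 i h1 hi).2 h0.symm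
      have h2 : ¬ i + 1 < m := fun h2 => (hind i m h2 le_rfl).2 hl
      omega
    · subst h'; exact G.loopless.irrefl _ hl
  refine hhole (m + 2) (by omega) (isIndContained_of_lt
    (fun i => if i.val ≤ m then p i.val else w) ?_ ?_)
  · intro i j hij
    have hij' : i.val < j.val := hij
    have hi : i.val ≤ m := by omega
    simp only [hi, if_true]
    split_ifs with hj
    · by_cases h : i.val + 1 < j.val
      · exact (hind _ _ h hj).1
      · have h2 : j.val = i.val + 1 := by omega
        rw [h2]
        exact (hstep i.val (by omega)).ne
    · exact hw _ hi
  · intro i j hij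
    have hij' : i.val < j.val := hij
    have hi : i.val ≤ m := by omega
    rw [cycleGraph_adj_of_lt hij]
    simp only [hi, if_true]
    split_ifs with hj
    · by_cases h : i.val + 1 < j.val
      · have := (hind _ _ h hj).2
        constructor
        · intro h3; exact absurd h3 this
        · intro h3; omega
      · have h2 : j.val = i.val + 1 := by omega
        rw [h2]
        simp [hstep i.val (by omega)]
    · have hj' : j.val = m + 1 := by omega
      rw [G.adj_comm]
      constructor
      · intro h
        by_contra hc
        exact hmid i.val (by omega) (by omega) h
      · intro h
        rcases h with h | h
        · have : i.val = m := by omega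
          rw [this]; exact hl
        · rw [h.1]; exact h0

theorem not_house (hhouse : ¬ house.IsIndContained G) {p q r s t : V}
    (hpq : G.Adj p q) (hqr : G.Adj q r) (hrs : G.Adj r s) (hsp : G.Adj s p)
    (hpr : ¬ G.Adj p r) (hqs : ¬ G.Adj q s) (hpr' : p ≠ r) (hqs' : q ≠ s)
    (htp : G.Adj t p) (htq : G.Adj t q) (htr : ¬ G.Adj t r) (hts : ¬ G.Adj t s) : False := by
  have htr' : t ≠ r := by rintro rfl; exact hpr htp.symm
  have hts' : t ≠ s := by rintro rfl; exact hqs htq.symm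
  refine hhouse (isIndContained_of_lt ![p, t, q, r, s] ?_ ?_)
  · intro i j hij
    fin_cases i <;> fin_cases j <;>
      simp [hpq.ne, hqr.ne, hrs.ne, hsp.ne', hpr', hqs', htp.ne', htq.ne, htr', hts'] at hij ⊢
  · intro i j hij
    fin_cases i <;> fin_cases j <;>
      simp [house, edge_adj, cycleGraph_adj', hpq, hqr, hrs, hsp.symm, hpr, hqs, htp.symm, htq,
        htr, hts] at hij ⊢ <;> decide

/-- In a subset connecting `a` to a target set, there is an induced path from `a` to the target set
all of whose vertices but the last one avoid the target set. -/
theorem exists_induced_path_to (S T : Set V) {a b : V} (hb : b ∈ T)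
    (hab : (G.induce S).spanningCoe.Reachable a b) :
    ∃ (m : ℕ) (p : ℕ → V), p 0 = a ∧ p m ∈ T ∧ (∀ i, i < m → p i ∉ T) ∧
      (∀ i, i < m → G.Adj (p i) (p (i + 1)) ∧ p i ∈ S ∧ p (i + 1) ∈ S) ∧
      (∀ i j, i + 1 < j → j ≤ m → p i ≠ p j ∧ ¬ G.Adj (p i) (p j)) := by
  classical
  set K := (G.induce S).spanningCoe with hK
  have hKadj : ∀ x y, K.Adj x y ↔ G.Adj x y ∧ x ∈ S ∧ y ∈ S := by
    intro x y
    simp [hK]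
  have hex : ∃ n, ∃ t ∈ T, ∃ w : K.Walk a t, w.length = n := by
    obtain ⟨w⟩ := hab
    exact ⟨_, b, hb, w, rfl⟩
  -- The walk is shortest among all walks to all targets: this makes it induced and also keeps its
  -- earlier vertices out of `T`.
  obtain ⟨t, htT, w, hw⟩ := Nat.find_spec hex
  have hmin : ∀ t' ∈ T, ∀ w' : K.Walk a t', w.length ≤ w'.length := by
    intro t' ht' w'
    rw [hw]
    exact Nat.find_min' hex ⟨t', ht', w', rfl⟩
  have hstep : ∀ i, i < w.length → K.Adj (w.getVert i) (w.getVert (i + 1)) :=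
    fun i hi => w.adj_getVert_succ hi
  have hshort : ∀ i j, i + 1 < j → j ≤ w.length →
      w.getVert i ≠ w.getVert j ∧ ¬ K.Adj (w.getVert i) (w.getVert j) := by
    intro i j hij hj
    have h1 : (w.take i).length = i := by rw [Walk.take_length]; omega
    have h2 : (w.drop j).length = w.length - j := Walk.drop_length ..
    constructor
    · intro h
      have := hmin t htT ((w.take i).append ((w.drop j).copy h.symm rfl))
      rw [Walk.length_append, Walk.length_copy, h1, h2] at this
      omega
    · intro h
      have := hmin t htT ((w.take i).append (Walk.cons h (w.drop j)))
      rw [Walk.length_append, Walk.length_cons, h1, h2] at this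
      omega
  refine ⟨w.length, w.getVert, by simp, by simpa using htT, ?_, ?_, ?_⟩
  · intro i hi hT
    have := hmin _ hT (w.take i)
    rw [Walk.take_length] at this
    omega
  · intro i hi
    exact (hKadj _ _).1 (hstep i hi)
  · intro i j hij hj
    refine ⟨(hshort i j hij hj).1, fun h => (hshort i j hij hj).2 ((hKadj _ _).2 ⟨h, ?_, ?_⟩)⟩
    · exact ((hKadj _ _).1 (hstep i (by omega))).2.1
    · have := ((hKadj _ _).1 (hstep (j - 1) (by omega))).2.2
      rwa [Nat.sub_add_cancel (by omega)] at this

theorem Connected.dist_le_add_one (hG : G.Connected) (z : V) {u v : V} (h : G.Adj u v) :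
    G.dist z u ≤ G.dist z v + 1 ∧ G.dist z v ≤ G.dist z u + 1 := by
  have h1 := hG.dist_triangle (u := z) (v := v) (w := u)
  have h2 := hG.dist_triangle (u := z) (v := u) (w := v)
  rw [dist_eq_one_iff_adj.2 h] at h2
  rw [dist_eq_one_iff_adj.2 h.symm] at h1
  exact ⟨h1, h2⟩

theorem Connected.exists_adj_dist_eq (hG : G.Connected) {z x : V} {n : ℕ}
    (h : G.dist z x = n + 1) : ∃ y, G.Adj x y ∧ G.dist z y = n := by
  obtain ⟨p, hp⟩ := hG.exists_walk_length_eq_dist x z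
  cases p with
  | nil => rw [dist_self] at h; omega
  | cons hxy q =>
    rename_i y
    refine ⟨y, hxy, ?_⟩
    have h1 := dist_le q
    have h2 := (hG.dist_le_add_one z hxy)
    rw [Walk.length_cons, dist_comm, h] at hp
    rw [dist_comm] at h1
    omega

theorem Connected.reachable_of_ball_subset (hG : G.Connected) {z : V} {n : ℕ} {S : Set V}
    (hS : ∀ y, G.dist z y ≤ n → y ∈ S) :
    ∀ k, k ≤ n → ∀ x, G.dist z x = k → (G.induce S).spanningCoe.Reachable x z := by
  intro k
  induction k with
  | zero =>
    intro _ x hx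
    rw [hG.dist_eq_zero_iff] at hx
    subst hx
    exact Reachable.refl _
  | succ k ih =>
    intro hk x hx
    obtain ⟨y, hxy, hy⟩ := hG.exists_adj_dist_eq hx
    refine Reachable.trans ?_ (ih (by omega) y hy)
    refine Adj.reachable ?_
    simpa using ⟨hxy, hS x (by omega), hS y (by omega)⟩

/-- The quadrangle condition of hole-free graphs. -/
theorem exists_adj_adj_of_quadrangle (hG : G.Connected)
    (hhole : ∀ k : ℕ, 5 ≤ k → ¬ (cycleGraph k).IsIndContained G) {z u v w : V} {k : ℕ}
    (hne : u ≠ v) (hnadj : ¬ G.Adj u v) (hwu : G.Adj w u) (hwv : G.Adj w v)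
    (hu : G.dist z u = k + 1) (hv : G.dist z v = k + 1) (hw : G.dist z w = k + 2) :
    ∃ q, G.Adj q u ∧ G.Adj q v ∧ G.dist z q = k := by
  -- An induced path from u to v inside the ball of radius k with u and v added has all inner
  -- vertices at distance at most k, so none is adjacent to w. Length two gives q; a longer path
  -- closes up with w to a hole.
  set S : Set V := {y | G.dist z y ≤ k ∨ y = u ∨ y = v} with hS
  have hball : ∀ y, G.dist z y ≤ k → y ∈ S := fun y hy => Or.inl hy
  have key : ∀ x, x ∈ S → G.dist z x = k + 1 → (G.induce S).spanningCoe.Reachable x z := by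
    intro x hxS hx
    obtain ⟨y, hxy, hy⟩ := hG.exists_adj_dist_eq hx
    refine Reachable.trans (Adj.reachable ?_) (hG.reachable_of_ball_subset hball k le_rfl y hy)
    simpa using ⟨hxy, hxS, hball y hy.le⟩
  have huS : u ∈ S := Or.inr (Or.inl rfl)
  have hvS : v ∈ S := Or.inr (Or.inr rfl)
  obtain ⟨m, p, hp0, hpm, hpT, hstep, hind⟩ :=
    exists_induced_path_to (G := G) S {v} rfl ((key u huS hu).trans (key v hvS hv).symm)
  have hpm' : p m = v := hpm
  have hmid : ∀ i, 0 < i → i < m → G.dist z (p i) ≤ k := by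
    intro i hi him
    rcases (hstep i him).2.1 with h | h | h
    · exact h
    · exfalso
      rw [← hp0] at h
      by_cases h1 : 0 + 1 < i
      · exact (hind 0 i h1 him.le).1 h.symm
      · have : i = 1 := by omega
        subst this
        exact (hstep 0 (by omega)).1.ne h.symm
    · exact absurd h (hpT i him)
  rcases m with _ | _ | _ | m
  · exact absurd (hp0.symm.trans hpm') hne
  · exact absurd (by simpa [hp0, hpm'] using (hstep 0 (by omega)).1) hnadj
  · have h1 := (hstep 0 (by omega)).1
    have h2 := (hstep 1 (by omega)).1
    have h3 := hmid 1 (by omega) (by omega)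
    simp only [zero_add, Nat.reduceAdd] at h1 h2 hpm'
    rw [hp0] at h1
    rw [hpm'] at h2
    refine ⟨p 1, h1.symm, h2, ?_⟩
    have := hG.dist_le_add_one z h1
    omega
  · exfalso
    refine not_induced_path_with_apex hhole (m := m + 3) (by omega) p w
      (fun i hi => (hstep i hi).1) hind (hp0 ▸ hwu) (hpm'.symm ▸ hwv) ?_
    intro i hi him hadj
    have h1 := hmid i hi him
    have := hG.dist_le_add_one z hadj
    omega

/-- The triangle condition of house- and hole-free graphs. -/
theorem exists_adj_adj_of_triangle (hG : G.Connected) (hfree : G.IsHouseHoleFree) {z : V} :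
    ∀ (k : ℕ) {u v : V}, G.Adj u v → G.dist z u = k + 1 → G.dist z v = k + 1 →
    ∃ q, G.Adj q u ∧ G.Adj q v ∧ G.dist z q = k := by
  intro k
  induction k with
  | zero =>
    intro u v _ hu hv
    exact ⟨z, by simpa using hu, by simpa using hv, by simp⟩
  | succ k ih =>
  intro u v huv hu hv
  set S : Set V := {y | G.dist z y ≤ k + 1 ∨ y = v} with hS
  have hball : ∀ y, G.dist z y ≤ k + 1 → y ∈ S := fun y hy => Or.inl hy
  have hvS : v ∈ S := Or.inr rfl
  obtain ⟨u', huu', hu'⟩ := hG.exists_adj_dist_eq hu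
  obtain ⟨v', hvv', hv'⟩ := hG.exists_adj_dist_eq hv
  have hr : (G.induce S).spanningCoe.Reachable v u' := by
    refine Reachable.trans (Adj.reachable (v := v') ?_)
      ((hG.reachable_of_ball_subset hball (k + 1) le_rfl v' hv').trans
        (hG.reachable_of_ball_subset hball (k + 1) le_rfl u' hu').symm)
    simpa using ⟨hvv', hvS, hball v' hv'.le⟩
  -- An induced path leads from v to its first neighbour of u in the ball. Length one gives q.
  -- Length two gives a 4-cycle, which the induction hypothesis one level lower roofs to a house.
  -- Longer paths give a hole through u.
  obtain ⟨m, p, hp0, hpm, hpT, hstep, hind⟩ :=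
    exists_induced_path_to (G := G) S {y | G.Adj u y ∧ G.dist z y ≤ k + 1} ⟨huu', hu'.le⟩ hr
  have hmid : ∀ i, 0 < i → i ≤ m → G.dist z (p i) ≤ k + 1 := by
    intro i hi him
    have hpS : p i ∈ S := by
      have := (hstep (i - 1) (by omega)).2.2
      rwa [Nat.sub_add_cancel (by omega)] at this
    rcases hpS with h | h
    · exact h
    · exfalso
      rw [← hp0] at h
      by_cases h1 : 0 + 1 < i
      · exact (hind 0 i h1 him).1 h.symm
      · have : i = 1 := by omega
        subst this
        exact (hstep 0 (by omega)).1.ne h.symm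
  rcases m with _ | _ | _ | m
  · have := hpm.2
    rw [hp0] at this
    omega
  · have h1 := (hstep 0 (by omega)).1
    simp only [zero_add, hp0] at h1 hpm
    refine ⟨p 1, hpm.1.symm, h1.symm, ?_⟩
    have := hG.dist_le_add_one z h1
    have := hpm.2
    omega
  · exfalso
    have h1 := (hstep 0 (by omega)).1
    have h2 := (hstep 1 (by omega)).1
    simp only [zero_add, Nat.reduceAdd, hp0] at h1 h2 hpm
    have hl1 := hmid 1 (by omega) (by omega)
    have hl1' := hG.dist_le_add_one z h1
    have hl2' := hG.dist_le_add_one z hpm.1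
    have hl2 := hpm.2
    obtain ⟨t, ht1, ht2, ht⟩ := ih h2 (by omega) (by omega)
    have hnu : ¬ G.Adj (p 1) u := fun h => hpT 1 (by omega) ⟨h.symm, hl1⟩
    have hnv : ¬ G.Adj (p 2) v := by
      intro h
      have := (hind 0 2 (by omega) (by omega)).2
      rw [hp0] at this
      exact this h.symm
    refine not_house hfree.1 h2 hpm.1.symm huv h1 hnu hnv ?_ ?_ ht1 ht2 ?_ ?_
    · rintro h; rw [h] at hl1; omega
    · rintro h; rw [h] at hl2; omega
    · intro h; have := hG.dist_le_add_one z h; omega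
    · intro h; have := hG.dist_le_add_one z h; omega
  · exfalso
    refine not_induced_path_with_apex hfree.2 (m := m + 3) (by omega) p u
      (fun i hi => (hstep i hi).1) hind (hp0 ▸ huv) hpm.1 ?_
    intro i hi him hadj
    exact hpT i him ⟨hadj, hmid i hi him.le⟩

theorem not_adj_of_two_le_dist {u v : V} (h : 2 ≤ G.dist u v) : ¬ G.Adj u v := by
  intro h'
  rw [dist_eq_one_iff_adj.2 h'] at h
  omega

theorem Connected.exists_adj_adj_of_dist_eq_two (hG : G.Connected) {u v : V}
    (h : G.dist u v = 2) : ∃ q, G.Adj q u ∧ G.Adj q v := by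
  obtain ⟨q, hq, hq'⟩ := hG.exists_adj_dist_eq h
  exact ⟨q, (dist_eq_one_iff_adj.1 hq').symm, hq.symm⟩

/-- Two crossing pairs at distance four whose cross distances are two span an induced octagon. -/
theorem not_octagon (hG : G.Connected)
    (hhole : ∀ k : ℕ, 5 ≤ k → ¬ (cycleGraph k).IsIndContained G) {a b a' b' : V}
    (hab : G.dist a b = 4) (hab' : G.dist a' b' = 4) (h1 : G.dist a a' = 2)
    (h2 : G.dist a' b = 2) (h3 : G.dist b b' = 2) (h4 : G.dist b' a = 2) : False := by
  obtain ⟨q1, q1a, q1a'⟩ := hG.exists_adj_adj_of_dist_eq_two h1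
  obtain ⟨q2, q2a', q2b⟩ := hG.exists_adj_adj_of_dist_eq_two h2
  obtain ⟨q3, q3b, q3b'⟩ := hG.exists_adj_adj_of_dist_eq_two h3
  obtain ⟨q4, q4b', q4a⟩ := hG.exists_adj_adj_of_dist_eq_two h4
  have far : ∀ {x y c d : V}, G.dist c d = 4 → G.Adj x c → G.Adj y d → x ≠ y ∧ ¬ G.Adj x y := by
    intro x y c d hcd hx hy
    have e1 := hG.dist_le_add_one c hy
    have e2 : G.dist c x = 1 := dist_eq_one_iff_adj.2 hx.symm
    constructor
    · rintro rfl; omega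
    · intro h; have := hG.dist_le_add_one c h; omega
  have far' : ∀ {x c d : V}, G.dist c d = 4 → G.Adj x c → x ≠ d ∧ ¬ G.Adj x d := by
    intro x c d hcd hx
    have e2 : G.dist c x = 1 := dist_eq_one_iff_adj.2 hx.symm
    constructor
    · rintro rfl; omega
    · intro h; have := hG.dist_le_add_one c h; omega
  have near : ∀ {c d : V}, 2 ≤ G.dist c d → c ≠ d ∧ ¬ G.Adj c d := by
    intro c d h
    refine ⟨?_, not_adj_of_two_le_dist h⟩
    rintro rfl
    simp at h
  have hba : G.dist b a = 4 := by rw [dist_comm]; exact hab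
  have hba' : G.dist b' a' = 4 := by rw [dist_comm]; exact hab'
  -- The octagon with corners a, a', b, b' and midpoints q1, ..., q4, cut open at a.
  let p : ℕ → V := fun i => match i with
    | 0 => q1 | 1 => a' | 2 => q2 | 3 => b | 4 => q3 | 5 => b' | _ => q4
  refine not_induced_path_with_apex hhole (m := 6) (by omega) p a ?_ ?_ q1a.symm q4a.symm ?_
  · intro i hi
    interval_cases i
    · exact q1a'
    · exact q2a'.symm
    · exact q2b
    · exact q3b.symm
    · exact q3b'
    · exact q4b'.symm
  · have s : ∀ {x y : V}, y ≠ x ∧ ¬ G.Adj y x → x ≠ y ∧ ¬ G.Adj x y :=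
      fun h => ⟨h.1.symm, fun h' => h.2 h'.symm⟩
    intro i j hij hj
    have hi : i < 5 := by omega
    interval_cases i <;> interval_cases j
    · exact far hab q1a q2b
    · exact far' hab q1a
    · exact far hab q1a q3b
    · exact far' hab' q1a'
    · exact far hab' q1a' q4b'
    · exact near h2.ge
    · exact s (far' hba' q3b')
    · exact near (c := a') (d := b') (by omega)
    · exact s (far' hba' q4b')
    · exact far hab' q2a' q3b'
    · exact far' hab' q2a'
    · exact far hba q2b q4a
    · exact near h3.ge
    · exact s (far' hab q4a)
    · exact far hba q3b q4a
  · intro i hi hi'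
    interval_cases i
    · exact (near h1.ge).2
    · exact fun h => (far' hba q2b).2 h.symm
    · exact not_adj_of_two_le_dist (u := a) (v := b) (by omega)
    · exact fun h => (far' hba q3b).2 h.symm
    · exact fun h => (near h4.ge).2 h.symm

/-! ### Edges that generate the same line -/

/-- Connected house- and hole-free graphs in which every edge lies in a triangle. -/
structure IsTriangleFull (G : SimpleGraph V) : Prop where
  conn : G.Connected
  free : G.IsHouseHoleFree
  exists_triangle : ∀ u v, G.Adj u v → ∃ a, G.Adj a u ∧ G.Adj a v

/-- Two vertices at distance two whose distances to every vertex have the same parity. -/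
def ParityTwins (G : SimpleGraph V) (a b : V) : Prop :=
  G.dist a b = 2 ∧ ∀ z, (G.dist z a + G.dist z b) % 2 = 0

theorem ParityTwins.symm {a b : V} (h : G.ParityTwins a b) : G.ParityTwins b a :=
  ⟨by rw [dist_comm]; exact h.1, fun z => by rw [add_comm]; exact h.2 z⟩

theorem ParityTwins.ne {a b : V} (h : G.ParityTwins a b) : a ≠ b := by
  rintro rfl
  simpa using h.1

theorem ParityTwins.not_adj {a b : V} (h : G.ParityTwins a b) : ¬ G.Adj a b :=
  not_adj_of_two_le_dist h.1.ge

theorem mem_metricLine_of_adj (hG : G.Connected) {u v : V} (h : G.Adj u v) (z : V) :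
    z ∈ G.metricLine u v ↔ G.dist z u ≠ G.dist z v := by
  have h1 := dist_eq_one_iff_adj.2 h
  have h2 := hG.dist_le_add_one z h
  have c1 := G.dist_comm (u := u) (v := z)
  have c2 := G.dist_comm (u := v) (v := z)
  have c3 := G.dist_comm (u := u) (v := v)
  have pu := hG.dist_eq_zero_iff (u := z) (v := u)
  have pv := hG.dist_eq_zero_iff (u := z) (v := v)
  have hne := h.ne
  have : ¬ (G.dist z u = 0 ∧ G.dist z v = 0) := by
    rintro ⟨h3, h4⟩
    exact hne ((pu.1 h3).symm.trans (pv.1 h4))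
  simp only [metricLine, AreCollinear, IsBetween, Set.mem_ofPred_eq]
  omega

theorem metricLine_comm (u v : V) : G.metricLine u v = G.metricLine v u := by
  ext z
  simp only [metricLine, AreCollinear, IsBetween, Set.mem_ofPred_eq]
  have c1 := G.dist_comm (u := u) (v := z)
  have c2 := G.dist_comm (u := v) (v := z)
  have c3 := G.dist_comm (u := u) (v := v)
  omega

theorem mem_metricLine_of_dist_eq_two {u v : V} (h : G.dist u v = 2) (z : V) :
    z ∈ G.metricLine u v ↔ G.dist z u = G.dist z v + 2 ∨ G.dist z v = G.dist z u + 2 ∨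
      (G.dist z u = 1 ∧ G.dist z v = 1) := by
  have c1 := G.dist_comm (u := u) (v := z)
  have c2 := G.dist_comm (u := v) (v := z)
  have c3 := G.dist_comm (u := u) (v := v)
  simp only [metricLine, AreCollinear, IsBetween, Set.mem_ofPred_eq]
  omega

theorem Connected.dist_le_add_two (hG : G.Connected) (z : V) {u v : V} (h : G.dist u v = 2) :
    G.dist z u ≤ G.dist z v + 2 ∧ G.dist z v ≤ G.dist z u + 2 := by
  have h1 := hG.dist_triangle (u := z) (v := v) (w := u)
  have h2 := hG.dist_triangle (u := z) (v := u) (w := v)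
  rw [h] at h2
  rw [G.dist_comm (u := v) (v := u), h] at h1
  exact ⟨h1, h2⟩

theorem Connected.not_adj_of_dist (hG : G.Connected) {z u v : V} {m n : ℕ} (hu : G.dist z u = m)
    (hv : G.dist z v = n) (h : m + 1 < n) : ¬ G.Adj u v := by
  intro h'
  have := hG.dist_le_add_one z h'
  omega

theorem ne_of_dist_lt {z u v : V} {m n : ℕ} (hu : G.dist z u = m) (hv : G.dist z v = n)
    (h : m < n) : u ≠ v := by
  rintro rfl
  omega

namespace IsTriangleFull

theorem house (hT : G.IsTriangleFull) {p q r s t : V}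
    (hpq : G.Adj p q) (hqr : G.Adj q r) (hrs : G.Adj r s) (hsp : G.Adj s p)
    (hpr : ¬ G.Adj p r) (hqs : ¬ G.Adj q s) (hpr' : p ≠ r) (hqs' : q ≠ s)
    (htp : G.Adj t p) (htq : G.Adj t q) (htr : ¬ G.Adj t r) (hts : ¬ G.Adj t s) : False :=
  not_house hT.free.1 hpq hqr hrs hsp hpr hqs hpr' hqs' htp htq htr hts

theorem tri (hT : G.IsTriangleFull) {z u v : V} {k : ℕ} (h : G.Adj u v)
    (hu : G.dist z u = k + 1) (hv : G.dist z v = k + 1) :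
    ∃ q, G.Adj q u ∧ G.Adj q v ∧ G.dist z q = k :=
  exists_adj_adj_of_triangle hT.conn hT.free k h hu hv

theorem quad (hT : G.IsTriangleFull) {z u v w : V} {k : ℕ}
    (hne : u ≠ v) (hnadj : ¬ G.Adj u v) (hwu : G.Adj w u) (hwv : G.Adj w v)
    (hu : G.dist z u = k + 1) (hv : G.dist z v = k + 1) (hw : G.dist z w = k + 2) :
    ∃ q, G.Adj q u ∧ G.Adj q v ∧ G.dist z q = k :=
  exists_adj_adj_of_quadrangle hT.conn hT.free.2 hne hnadj hwu hwv hu hv hw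

variable {u v x y : V}

/-- The edges lie like v, u, ..., x, y on a geodesic. An apex a over uv is equidistant from x and y,
at distance j + 2. The triangle condition from y on the edge ua and the quadrangle condition below u
then build a 4-cycle roofed by a. -/
theorem not_antiparallel (hT : G.IsTriangleFull) (huv : G.Adj u v) (hxy : G.Adj x y)
    (heq : ∀ z, G.dist z u = G.dist z v ↔ G.dist z x = G.dist z y) {j : ℕ}
    (hxu : G.dist x u = j + 1) (hyu : G.dist y u = j + 2) (hxv : G.dist x v = j + 2)
    (hyv : G.dist y v = j + 3) : False := by
  have hG := hT.conn
  obtain ⟨a, hau, hav⟩ := hT.exists_triangle u v huv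
  have ha : G.dist a x = G.dist a y := by
    rw [← heq, dist_eq_one_iff_adj.2 hau, dist_eq_one_iff_adj.2 hav]
  have a1 := hG.dist_le_add_one x hau
  have a2 := hG.dist_le_add_one y hav
  have c1 := G.dist_comm (u := a) (v := x)
  have c2 := G.dist_comm (u := a) (v := y)
  obtain ⟨q, hqu, hqa, hq⟩ := hT.tri (z := y) (k := j + 1) hau.symm (by omega) (by omega)
  have q1 := hG.dist_le_add_one x hqa
  have q2 := hG.dist_le_add_one x hqu
  have c3 := G.dist_comm (u := q) (v := x)
  have c4 := G.dist_comm (u := q) (v := y)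
  have hqx : G.dist x q = j + 2 := by
    by_contra hne
    have h1 : G.dist q u = G.dist q v := (heq q).2 (by omega)
    rw [dist_eq_one_iff_adj.2 hqu] at h1
    have := hG.dist_le_add_one y (dist_eq_one_iff_adj.1 h1.symm)
    omega
  obtain ⟨u1, huu1, hu1⟩ := hG.exists_adj_dist_eq hxu
  have e1 := hG.dist_le_add_one u1 hxy
  have e2 := hG.dist_le_add_one y huu1
  have c5 := G.dist_comm (u := u1) (v := x)
  have c6 := G.dist_comm (u := u1) (v := y)
  have hqu1 : ¬ G.Adj q u1 := fun h => by have := hG.dist_le_add_one x h; omega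
  have hqu1' : q ≠ u1 := by rintro rfl; omega
  obtain ⟨r, hrq, hru1, hr⟩ := hT.quad (z := y) (k := j) hqu1' hqu1 hqu.symm huu1
    (by omega) (by omega) (by omega)
  refine hT.house hqu.symm hrq.symm hru1 huu1.symm ?_ hqu1 ?_ hqu1' hau hqa.symm ?_ ?_
  · intro h; have := hG.dist_le_add_one y h; omega
  · rintro rfl; omega
  · intro h; have := hG.dist_le_add_one y h; omega
  · intro h; have := hG.dist_le_add_one x h; omega

/-- The case of `not_parallel` where the apex a is adjacent to u1. A neighbour a1 of a that is
nearer to both x and y is tested against the 4-cycle u, v, r, u1; every possible adjacency of a1 and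
r yields a house. -/
theorem not_parallel_aux (hT : G.IsTriangleFull) (huv : G.Adj u v) (hxy : G.Adj x y) {j : ℕ}
    (hxu : G.dist x u = j + 2) (hyu : G.dist y u = j + 3) (hxv : G.dist x v = j + 3)
    (hyv : G.dist y v = j + 2) {a u1 r : V} (hau : G.Adj a u) (hav : G.Adj a v)
    (hax : G.dist x a = j + 2) (hay : G.dist y a = j + 2) (huu1 : G.Adj u u1)
    (hu1x : G.dist x u1 = j + 1) (hu1y : G.dist y u1 = j + 2) (hvr : G.Adj v r)
    (hry : G.dist y r = j + 1) (hru1 : G.Adj r u1)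
    (hau1 : G.Adj a u1) : False := by
  have hG := hT.conn
  have hru : ¬ G.Adj r u := hG.not_adj_of_dist hry hyu (by simp)
  have hur' : r ≠ u := ne_of_dist_lt hry hyu (by simp)
  have hu1v : ¬ G.Adj u1 v := hG.not_adj_of_dist hu1x hxv (by simp)
  have hvu1' : u1 ≠ v := ne_of_dist_lt hu1x hxv (by simp)
  -- The triangle condition is applied from a to the edge xy; a1 is the first step from a towards
  -- the common neighbour w it provides.
  obtain ⟨a1, haa1, ha1x, ha1y⟩ : ∃ a1, G.Adj a a1 ∧ G.dist x a1 = j + 1 ∧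
      G.dist y a1 = j + 1 := by
    clear * - hT hG hax hay hxy
    obtain ⟨w, hwx, hwy, hw⟩ := hT.tri (z := a) (k := j + 1) hxy
      (by rw [dist_comm]; exact hax) (by rw [dist_comm]; exact hay)
    obtain ⟨a1, haa1, ha1⟩ := hG.exists_adj_dist_eq (z := w) (x := a) (n := j)
      (by rw [dist_comm]; exact hw)
    have b1 := (hG.dist_le_add_one a1 hwx).2
    have b2 := (hG.dist_le_add_one a1 hwy).2
    have b3 := (hG.dist_le_add_one x haa1).1
    have b4 := (hG.dist_le_add_one y haa1).1
    rw [G.dist_comm (u := a1) (v := w), ha1, dist_comm] at b1 b2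
    exact ⟨a1, haa1, by omega, by omega⟩
  have ha1u : ¬ G.Adj a1 u := hG.not_adj_of_dist ha1y hyu (by simp)
  have ha1v : ¬ G.Adj a1 v := hG.not_adj_of_dist ha1x hxv (by simp)
  have ha1u1' : a1 ≠ u1 := ne_of_dist_lt ha1y hu1y (by simp)
  have hra1 : ¬ (G.Adj r a1 ∧ G.Adj u1 a1) := fun h =>
    hT.house hru1 huu1.symm huv hvr hru hu1v hur' hvu1' h.1.symm h.2.symm ha1u ha1v
  have ha1u1 : G.Adj u1 a1 := by
    by_contra hn
    obtain ⟨t, htu1, hta1, ht⟩ := hT.quad (z := x) (k := j) ha1u1'.symm hn hau1 haa1 hu1x ha1x hax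
    exact hT.house hau1 htu1.symm hta1 haa1.symm
      (fun h => hG.not_adj_of_dist ht hax (by simp) h.symm) hn
      (ne_of_dist_lt ht hax (by simp)).symm ha1u1'.symm hau.symm huu1
      (fun h => hG.not_adj_of_dist ht hxu (by simp) h.symm) (fun h => ha1u h.symm)
  have hra1 : ¬ G.Adj r a1 := fun h => hra1 ⟨h, ha1u1⟩
  have ha1r' : r ≠ a1 := by
    rintro rfl
    exact ha1v hvr.symm
  have har : ¬ G.Adj a r := by
    intro har
    obtain ⟨t, htr, hta1, ht⟩ := hT.quad (z := y) (k := j) ha1r' hra1 har haa1 hry ha1y hay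
    exact hT.house har htr.symm hta1 haa1.symm
      (fun h => hG.not_adj_of_dist ht hay (by simp) h.symm) hra1
      (ne_of_dist_lt ht hay (by simp)).symm ha1r' hav.symm hvr
      (fun h => hG.not_adj_of_dist ht hyv (by simp) h.symm) (fun h => ha1v h.symm)
  obtain ⟨t, htr, hta1, ht⟩ := hT.quad (z := y) (k := j) ha1r' hra1 hru1.symm ha1u1 hry ha1y hu1y
  exact hT.house ha1u1 hta1.symm htr hru1
    (fun h => hG.not_adj_of_dist ht hu1y (by simp) h.symm) (fun h => hra1 h.symm)
    (ne_of_dist_lt ht hu1y (by simp)).symm ha1r'.symm hau1 haa1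
    (fun h => hG.not_adj_of_dist ht hay (by simp) h.symm) har

/-- The edges face each other like opposite sides of a long ladder. The quadrangle condition gives a
4-cycle u, v, r, u1, and an apex a over uv must be adjacent to r or to u1 to avoid a house. The two
cases are mirror images. -/
theorem not_parallel (hT : G.IsTriangleFull) (huv : G.Adj u v) (hxy : G.Adj x y)
    (heq : ∀ z, G.dist z u = G.dist z v ↔ G.dist z x = G.dist z y) {j : ℕ}
    (hxu : G.dist x u = j + 2) (hyu : G.dist y u = j + 3) (hxv : G.dist x v = j + 3)
    (hyv : G.dist y v = j + 2) : False := by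
  have hG := hT.conn
  obtain ⟨a, hau, hav⟩ := hT.exists_triangle u v huv
  have ha : G.dist a x = G.dist a y := by
    rw [← heq, dist_eq_one_iff_adj.2 hau, dist_eq_one_iff_adj.2 hav]
  have a1 := hG.dist_le_add_one x hau
  have a2 := hG.dist_le_add_one y hav
  have a3 := hG.dist_le_add_one x hav
  have c1 := G.dist_comm (u := a) (v := x)
  have c2 := G.dist_comm (u := a) (v := y)
  obtain ⟨u1, huu1, hu1x⟩ := hG.exists_adj_dist_eq hxu
  have e1 := hG.dist_le_add_one u1 hxy
  have e2 := hG.dist_le_add_one y huu1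
  have c5 := G.dist_comm (u := u1) (v := x)
  have c6 := G.dist_comm (u := u1) (v := y)
  have hvu1 : ¬ G.Adj v u1 := fun h => by have := hG.dist_le_add_one x h; omega
  have hvu1' : v ≠ u1 := by rintro rfl; omega
  obtain ⟨r, hrv, hru1, hry⟩ := hT.quad (z := y) (k := j + 1) hvu1' hvu1 huv huu1
    (by omega) (by omega) (by omega)
  have r1 := hG.dist_le_add_one x hrv
  have r2 := hG.dist_le_add_one x hru1
  have hur : ¬ G.Adj u r := fun h => by have := hG.dist_le_add_one y h; omega
  have hur' : u ≠ r := by rintro rfl; omega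
  by_cases hau1 : G.Adj a u1
  · have := hG.dist_le_add_one x hau1
    exact hT.not_parallel_aux huv hxy hxu hyu hxv hyv hau hav (by omega) (by omega) huu1 hu1x
      (by omega) hrv.symm hry hru1 hau1
  · by_cases har : G.Adj a r
    · have := hG.dist_le_add_one y har
      exact hT.not_parallel_aux huv.symm hxy.symm hyv hxv hyu hxu hav hau (by omega) (by omega)
        hrv.symm hry (by omega) huu1 hu1x hru1.symm har
    · exact hT.house huv hrv.symm hru1 huu1.symm hur hvu1 hur' hvu1' hau hav har hau1

/-- If y were one step farther from z than u, then u would be equidistant from z with v or with x,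
and the triangle condition on that side would roof the induced 4-cycle u, v, y, x. Excluding a
difference of one between opposite corners makes them parity twins. -/
theorem dist_ne_add_one_of_wheel (hT : G.IsTriangleFull) (huv : G.Adj u v) (hxy : G.Adj x y)
    (hux : G.Adj u x) (hvy : G.Adj v y) (huy : G.dist u y = 2) (hvx : G.dist v x = 2)
    (heq : ∀ z, G.dist z u = G.dist z v ↔ G.dist z x = G.dist z y) (z : V) :
    G.dist z y ≠ G.dist z u + 1 := by
  intro hz
  have hG := hT.conn
  have e1 := hG.dist_le_add_one z huv
  have e2 := hG.dist_le_add_one z hux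
  have e3 := hG.dist_le_add_one z hvy
  have e4 := hG.dist_le_add_one z hxy
  have e5 := heq z
  have huy' : u ≠ y := by rintro rfl; simp at huy
  have hvx' : v ≠ x := by rintro rfl; simp at hvx
  have nuy := not_adj_of_two_le_dist huy.ge
  have nvx := not_adj_of_two_le_dist hvx.ge
  have hpos : 0 < G.dist z u := by
    rcases Nat.eq_zero_or_pos (G.dist z u) with h | h
    · rw [hG.dist_eq_zero_iff] at h
      subst h
      omega
    · exact h
  obtain ⟨k, hk⟩ := Nat.exists_eq_add_of_lt hpos
  by_cases h : G.dist z u = G.dist z v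
  · obtain ⟨q, hqu, hqv, hq⟩ := hT.tri (z := z) (k := k) huv (by omega) (by omega)
    have := e5.1 h
    refine hT.house huv hvy hxy.symm hux.symm nuy nvx huy' hvx' hqu hqv ?_ ?_
    · intro h; have := hG.dist_le_add_one z h; omega
    · intro h; have := hG.dist_le_add_one z h; omega
  · have : G.dist z x ≠ G.dist z y := fun h' => h (e5.2 h')
    obtain ⟨q, hqu, hqx, hq⟩ := hT.tri (z := z) (k := k) hux (by omega) (by omega)
    refine hT.house hux hxy hvy.symm huv.symm nuy (fun h => nvx h.symm) huy' hvx'.symm hqu hqx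
      ?_ ?_
    · intro h; have := hG.dist_le_add_one z h; omega
    · intro h; have := hG.dist_le_add_one z h; omega

theorem parityTwins_of_wheel (hT : G.IsTriangleFull) (huv : G.Adj u v) (hxy : G.Adj x y)
    (hux : G.Adj u x) (hvy : G.Adj v y) (huy : G.dist u y = 2) (hvx : G.dist v x = 2)
    (heq : ∀ z, G.dist z u = G.dist z v ↔ G.dist z x = G.dist z y) : G.ParityTwins u y := by
  refine ⟨huy, fun z => ?_⟩
  have h1 := hT.dist_ne_add_one_of_wheel huv hxy hux hvy huy hvx heq z
  have h2 := hT.dist_ne_add_one_of_wheel hxy.symm huv.symm hvy.symm hux.symm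
    (by rw [dist_comm]; exact huy) (by rw [dist_comm]; exact hvx)
    (fun z => by rw [eq_comm, ← heq z, eq_comm]) z
  have h3 := hT.conn.dist_le_add_two z huy
  omega

end IsTriangleFull

/-- The edges `uv` and `xy` coincide up to parity twins, in a complete bipartite way, and the
common neighbours of `u` and `v` are also common neighbours of `x` and `y`. -/
def EdgeMatch (G : SimpleGraph V) (u v x y : V) : Prop :=
  (u = x ∨ G.ParityTwins u x) ∧ (v = y ∨ G.ParityTwins v y) ∧ G.Adj u y ∧ G.Adj x v ∧
    ∀ a, G.Adj a u → G.Adj a v → G.Adj a x ∧ G.Adj a y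

theorem EdgeMatch.swap {u v x y : V} (h : G.EdgeMatch u v x y) : G.EdgeMatch v u y x :=
  ⟨h.2.1, h.1, h.2.2.2.1.symm, h.2.2.1.symm, fun a h1 h2 => (h.2.2.2.2 a h2 h1).symm⟩

namespace IsTriangleFull

variable {u v x y : V}

theorem edgeMatch_of_dist_le (hT : G.IsTriangleFull) (huv : G.Adj u v) (hxy : G.Adj x y)
    (heq : ∀ z, G.dist z u = G.dist z v ↔ G.dist z x = G.dist z y)
    (h1 : G.dist x u ≤ G.dist x v) (h2 : G.dist x u ≤ G.dist y u) (h3 : G.dist x u ≤ G.dist y v) :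
    G.EdgeMatch u v x y ∨ G.EdgeMatch u v y x := by
  have hG := hT.conn
  have n1 : G.dist u x ≠ G.dist u y := by
    rw [Ne, ← heq, dist_self, dist_eq_one_iff_adj.2 huv]; simp
  have n2 : G.dist v x ≠ G.dist v y := by
    rw [Ne, ← heq, dist_self, dist_eq_one_iff_adj.2 huv.symm]; simp
  have n3 : G.dist x u ≠ G.dist x v := by
    rw [Ne, heq, dist_self, dist_eq_one_iff_adj.2 hxy]; simp
  have n4 : G.dist y u ≠ G.dist y v := by
    rw [Ne, heq, dist_self, dist_eq_one_iff_adj.2 hxy.symm]; simp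
  have c1 := G.dist_comm (u := u) (v := x)
  have c2 := G.dist_comm (u := u) (v := y)
  have c3 := G.dist_comm (u := v) (v := x)
  have c4 := G.dist_comm (u := v) (v := y)
  have e1 := hG.dist_le_add_one u hxy
  have e2 := hG.dist_le_add_one v hxy
  have e3 := hG.dist_le_add_one x huv
  have e4 := hG.dist_le_add_one y huv
  rcases Nat.eq_zero_or_pos (G.dist x u) with h0 | h0
  · left
    have hxu := (hG.dist_eq_zero_iff.1 h0)
    subst hxu
    refine ⟨Or.inl rfl, ?_, hxy, huv, fun a hax hav => ⟨hax, ?_⟩⟩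
    · by_cases hvy : v = y
      · exact Or.inl hvy
      right
      have hpos := hG.pos_dist_of_ne hvy
      refine ⟨by omega, fun z => ?_⟩
      have f1 := hG.dist_le_add_one z huv
      have f2 := hG.dist_le_add_one z hxy
      have f3 := heq z
      omega
    · have h := (heq a).1 (by rw [dist_eq_one_iff_adj.2 hax, dist_eq_one_iff_adj.2 hav])
      rw [dist_eq_one_iff_adj.2 hax] at h
      exact dist_eq_one_iff_adj.1 h.symm
  obtain ⟨k, hk⟩ := Nat.exists_eq_add_of_lt h0
  rw [zero_add] at hk
  -- Minimality of d(x, u) and the inequalities `n1`–`n4` force d(x, v) = d(y, u) = k + 2 and d(y,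
  -- v) = k + 1 or k + 3. Only k + 1 with k = 0, an induced 4-cycle, survives.
  by_cases hap : G.dist y v = k + 3
  · exact (hT.not_antiparallel huv hxy heq hk (by omega) (by omega) hap).elim
  rcases k with _ | j
  · right
    have hux : G.Adj u x := dist_eq_one_iff_adj.1 (by omega)
    have hvy : G.Adj v y := dist_eq_one_iff_adj.1 (by omega)
    have huy : G.dist u y = 2 := by omega
    have hvx : G.dist v x = 2 := by omega
    refine ⟨Or.inr (hT.parityTwins_of_wheel huv hxy hux hvy huy hvx heq),
      Or.inr (hT.parityTwins_of_wheel huv.symm hxy.symm hvy hux hvx huy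
        (fun z => by rw [eq_comm, heq z, eq_comm])), hux, hvy.symm, fun a hau hav => ?_⟩
    have h := (heq a).1 (by rw [dist_eq_one_iff_adj.2 hau, dist_eq_one_iff_adj.2 hav])
    have huy' : u ≠ y := by rintro rfl; simp at huy
    have hvx' : v ≠ x := by rintro rfl; simp at hvx
    by_cases hax : G.Adj a x
    · rw [dist_eq_one_iff_adj.2 hax] at h
      exact ⟨dist_eq_one_iff_adj.1 h.symm, hax⟩
    · by_cases hay : G.Adj a y
      · rw [dist_eq_one_iff_adj.2 hay] at h
        exact ⟨hay, dist_eq_one_iff_adj.1 h⟩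
      · exact (hT.house huv hvy hxy.symm hux.symm (not_adj_of_two_le_dist huy.ge)
          (not_adj_of_two_le_dist hvx.ge) huy' hvx' hau hav hay hax).elim
  · exact (hT.not_parallel huv hxy heq hk (by omega) (by omega) (by omega)).elim

/-- Two edges defining the same line match up to parity twins. -/
theorem edgeMatch_of_metricLine_eq (hT : G.IsTriangleFull) (huv : G.Adj u v) (hxy : G.Adj x y)
    (h : G.metricLine u v = G.metricLine x y) : G.EdgeMatch u v x y ∨ G.EdgeMatch u v y x := by
  have heq : ∀ z, G.dist z u = G.dist z v ↔ G.dist z x = G.dist z y := by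
    intro z
    have := Set.ext_iff.1 h z
    rw [mem_metricLine_of_adj hT.conn huv, mem_metricLine_of_adj hT.conn hxy] at this
    exact not_iff_not.1 this
  have heq' : ∀ z, G.dist z u = G.dist z v ↔ G.dist z y = G.dist z x :=
    fun z => (heq z).trans eq_comm
  have heq2 : ∀ z, G.dist z v = G.dist z u ↔ G.dist z x = G.dist z y :=
    fun z => eq_comm.trans (heq z)
  have heq3 : ∀ z, G.dist z v = G.dist z u ↔ G.dist z y = G.dist z x :=
    fun z => eq_comm.trans (heq' z)
  by_cases m1 : G.dist x u ≤ G.dist x v ∧ G.dist x u ≤ G.dist y u ∧ G.dist x u ≤ G.dist y v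
  · exact hT.edgeMatch_of_dist_le huv hxy heq m1.1 m1.2.1 m1.2.2
  by_cases m2 : G.dist y u ≤ G.dist y v ∧ G.dist y u ≤ G.dist x u ∧ G.dist y u ≤ G.dist x v
  · exact (hT.edgeMatch_of_dist_le huv hxy.symm heq' m2.1 m2.2.1 m2.2.2).symm
  by_cases m3 : G.dist x v ≤ G.dist x u ∧ G.dist x v ≤ G.dist y v ∧ G.dist x v ≤ G.dist y u
  · exact ((hT.edgeMatch_of_dist_le huv.symm hxy heq2 m3.1 m3.2.1 m3.2.2).imp
      EdgeMatch.swap EdgeMatch.swap).symm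
  · exact (hT.edgeMatch_of_dist_le huv.symm hxy.symm heq3 (by omega) (by omega) (by omega)).imp
      EdgeMatch.swap EdgeMatch.swap

end IsTriangleFull

/-! ### Lines of parity twins -/

namespace ParityTwins

variable {v y : V}

theorem trichotomy (h : G.ParityTwins v y) (hG : G.Connected) (z : V) :
    G.dist z v = G.dist z y ∨ G.dist z v = G.dist z y + 2 ∨ G.dist z y = G.dist z v + 2 := by
  have h1 := hG.dist_le_add_two z h.1
  have h2 := h.2 z
  omega

/-- Equal distances off the line are at least two, because common neighbours lie on it; hence the
form k + 2. -/
theorem dist_eq_of_notMem (h : G.ParityTwins v y) (hG : G.Connected) {z : V}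
    (hz : z ∉ G.metricLine v y) : ∃ k, G.dist z v = k + 2 ∧ G.dist z y = k + 2 := by
  rw [mem_metricLine_of_dist_eq_two h.1] at hz
  have h1 := h.trichotomy hG z
  have h3 : ¬ (G.dist z v = 0 ∧ G.dist z y = 0) := by
    rintro ⟨h3, h4⟩
    exact h.ne ((hG.dist_eq_zero_iff.1 h3).symm.trans (hG.dist_eq_zero_iff.1 h4))
  exact ⟨G.dist z v - 2, by omega, by omega⟩

theorem adj_of_dist_le_two (h : G.ParityTwins v y) {a : V} (hav : G.Adj a v)
    (hay : G.dist a y ≤ 2) : G.Adj a y := by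
  have h1 := h.2 a
  have h2 := dist_eq_one_iff_adj.2 hav
  rw [← dist_eq_one_iff_adj]
  omega

/-- An arbitrary common neighbour is pushed towards z, by the triangle condition from level k + 1
(parity restores adjacency to y) or by the quadrangle condition from level k + 2. -/
theorem exists_hub (h : G.ParityTwins v y) (hT : G.IsTriangleFull) {z : V} {k : ℕ}
    (hv : G.dist z v = k + 1) (hy : G.dist z y = k + 1) :
    ∃ c, G.Adj c v ∧ G.Adj c y ∧ G.dist z c = k := by
  obtain ⟨c, hcv, hcy⟩ := hT.conn.exists_adj_adj_of_dist_eq_two h.1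
  have h1 := hT.conn.dist_le_add_one z hcv
  have h2 : G.dist z c = k ∨ G.dist z c = k + 1 ∨ G.dist z c = k + 2 := by omega
  rcases h2 with h2 | h2 | h2
  · exact ⟨c, hcv, hcy, h2⟩
  · obtain ⟨q, hqc, hqv, hq⟩ := hT.tri hcv h2 hv
    refine ⟨q, hqv, h.adj_of_dist_le_two hqv ?_, hq⟩
    have := (hT.conn.dist_le_add_one q hcy).2
    rwa [dist_eq_one_iff_adj.2 hqc] at this
  · exact hT.quad h.ne h.not_adj hcv hcy hv hy h2

theorem exists_adj_hubs (h : G.ParityTwins v y) (hT : G.IsTriangleFull) :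
    ∃ c b, G.Adj c b ∧ G.Adj c v ∧ G.Adj c y ∧ G.Adj b v ∧ G.Adj b y := by
  obtain ⟨c, hcv, hcy⟩ := hT.conn.exists_adj_adj_of_dist_eq_two h.1
  obtain ⟨b, hbc, hbv⟩ := hT.exists_triangle c v hcv
  refine ⟨c, b, hbc.symm, hcv, hcy, hbv, h.adj_of_dist_le_two hbv ?_⟩
  have := (hT.conn.dist_le_add_one b hcy).2
  rwa [dist_eq_one_iff_adj.2 hbc] at this

/-- An apex over xz is off the line, hence equidistant from v and y. Being on the line of the twins
then makes the distances from v to x and z, or those from y, equal, or makes them differ by two;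
neither can happen if v and y are on the line of the edge xz. -/
theorem metricLine_ne_of_adj (h : G.ParityTwins v y) (hT : G.IsTriangleFull) {x z : V}
    (hxz : G.Adj x z) : G.metricLine v y ≠ G.metricLine x z := by
  intro heq
  have hG := hT.conn
  obtain ⟨a, hax, haz⟩ := hT.exists_triangle x z hxz
  have ha : a ∉ G.metricLine v y := by
    rw [heq, mem_metricLine_of_adj hG hxz, dist_eq_one_iff_adj.2 hax, dist_eq_one_iff_adj.2 haz]
    simp
  obtain ⟨k, hkv, hky⟩ := h.dist_eq_of_notMem hG ha
  have hx : x ∈ G.metricLine v y := by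
    rw [heq, mem_metricLine_of_adj hG hxz, dist_self, dist_eq_one_iff_adj.2 hxz]; simp
  have hz : z ∈ G.metricLine v y := by
    rw [heq, mem_metricLine_of_adj hG hxz, dist_self, dist_eq_one_iff_adj.2 hxz.symm]; simp
  have hv : v ∈ G.metricLine x z := by
    rw [← heq, mem_metricLine_of_dist_eq_two h.1, dist_self, h.1]; simp
  have hy : y ∈ G.metricLine x z := by
    rw [← heq, mem_metricLine_of_dist_eq_two h.1, dist_self, dist_comm, h.1]; simp
  rw [mem_metricLine_of_dist_eq_two h.1] at hx hz
  rw [mem_metricLine_of_adj hG hxz, G.dist_comm (u := v), G.dist_comm (u := v)] at hv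
  rw [mem_metricLine_of_adj hG hxz, G.dist_comm (u := y), G.dist_comm (u := y)] at hy
  have e1 := hG.dist_le_add_one v hax
  have e2 := hG.dist_le_add_one v haz
  have e3 := hG.dist_le_add_one v hxz
  rw [G.dist_comm (u := v) (v := a), G.dist_comm (u := v) (v := x)] at e1
  rw [G.dist_comm (u := v) (v := a), G.dist_comm (u := v) (v := z)] at e2
  rw [G.dist_comm (u := v) (v := x), G.dist_comm (u := v) (v := z)] at e3
  have f1 := hG.dist_le_add_one y hax
  have f2 := hG.dist_le_add_one y haz
  have f3 := hG.dist_le_add_one y hxz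
  rw [G.dist_comm (u := y) (v := a), G.dist_comm (u := y) (v := x)] at f1
  rw [G.dist_comm (u := y) (v := a), G.dist_comm (u := y) (v := z)] at f2
  rw [G.dist_comm (u := y) (v := x), G.dist_comm (u := y) (v := z)] at f3
  clear * - hkv hky hx hz hv hy e1 e2 e3 f1 f2 f3
  omega

end ParityTwins

/-- No two distinct vertices have the same neighbourhood. -/
def IsFalseTwinFree (G : SimpleGraph V) : Prop :=
  ∀ a b, (∀ z, G.Adj z a ↔ G.Adj z b) → a = b

theorem ParityTwins.exists_private {v y : V} (h : G.ParityTwins v y) (hG : G.Connected)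
    (htf : G.IsFalseTwinFree) :
    ∃ t, (G.dist t v = 1 ∧ G.dist t y = 3) ∨ (G.dist t y = 1 ∧ G.dist t v = 3) := by
  by_contra hno
  refine h.ne (htf v y fun z => ?_)
  have h1 := h.trichotomy hG z
  have h2 : ¬ ((G.dist z v = 1 ∧ G.dist z y = 3) ∨ (G.dist z y = 1 ∧ G.dist z v = 3)) :=
    fun h' => hno ⟨z, h'⟩
  rw [← dist_eq_one_iff_adj, ← dist_eq_one_iff_adj]
  omega

theorem ParityTwins.dist_eq_four_of_metricLine_eq {v y x : V} (h : G.ParityTwins v y)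
    (h' : G.ParityTwins v x) (hG : G.Connected) (heq : G.metricLine v y = G.metricLine v x)
    (hne : y ≠ x) : G.dist y x = 4 := by
  have hy : y ∈ G.metricLine v x := by
    rw [← heq, mem_metricLine_of_dist_eq_two h.1, dist_self, dist_comm, h.1]; simp
  rw [mem_metricLine_of_dist_eq_two h'.1, G.dist_comm (u := y) (v := v), h.1] at hy
  have : G.dist y x ≠ 0 := by rwa [Ne, hG.dist_eq_zero_iff]
  omega

namespace IsTriangleFull

variable {u v x y : V}

/-- The pairs are aligned as x, u, v, y. From a vertex z off the line, hubs and the quadrangle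
condition produce a neighbour r of v that has distance 3 from y, so r is on the line of vy, but
distance i + 2 from both u and x, so r is off the line of ux. -/
theorem metricLine_eq_univ_of_aligned (hT : G.IsTriangleFull) (h : G.ParityTwins v y)
    (h' : G.ParityTwins u x) (heq : G.metricLine v y = G.metricLine u x) {i : ℕ}
    (huv : G.dist u v = i + 1) (huy : G.dist u y = i + 3) (hxv : G.dist x v = i + 3)
    (hxy : G.dist x y = i + 5) : G.metricLine v y = Set.univ := by
  have hG := hT.conn
  by_contra hL
  obtain ⟨z, hz⟩ := (Set.ne_univ_iff_exists_notMem _).1 hL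
  obtain ⟨k, hkv, hky⟩ := h.dist_eq_of_notMem hG hz
  obtain ⟨c, hcv, hcy, hc⟩ := h.exists_hub hT hkv hky
  obtain ⟨p, hcp, hp⟩ := hG.exists_adj_dist_eq hc
  have hpv : G.dist p v = 2 := by
    have h1 := (hG.dist_le_add_one p hcv).2
    rw [dist_eq_one_iff_adj.2 hcp.symm] at h1
    have h2 := hG.dist_triangle (u := z) (v := p) (w := v)
    omega
  have hpy : G.dist p y = 2 := by
    have h1 := (hG.dist_le_add_one p hcy).2
    rw [dist_eq_one_iff_adj.2 hcp.symm] at h1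
    have h2 := hG.dist_triangle (u := z) (v := p) (w := y)
    omega
  have hpL : p ∉ G.metricLine u x := by
    rw [← heq, mem_metricLine_of_dist_eq_two h.1, hpv, hpy]; simp
  obtain ⟨j, hju, hjx⟩ := h'.dist_eq_of_notMem hG hpL
  have hj : j = i + 1 := by
    have h1 := hG.dist_triangle (u := p) (v := v) (w := u)
    have h2 := hG.dist_triangle (u := x) (v := p) (w := y)
    rw [G.dist_comm (u := v) (v := u)] at h1
    rw [G.dist_comm (u := x) (v := p)] at h2
    omega
  subst hj
  obtain ⟨g, hgu, hgx, hg⟩ := h'.exists_hub hT hju hjx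
  rw [dist_comm] at hg
  have hgv : G.dist g v = i + 2 := by
    have h1 := hG.dist_le_add_one v hgx
    have h2 := hG.dist_le_add_one v hgu
    rw [G.dist_comm (u := v) (v := g), G.dist_comm (u := v) (v := x)] at h1
    rw [G.dist_comm (u := v) (v := g), G.dist_comm (u := v) (v := u)] at h2
    omega
  have hgy : G.dist g y ≥ i + 4 := by
    have h1 := hG.dist_le_add_one y hgx
    rw [G.dist_comm (u := y) (v := g), G.dist_comm (u := y) (v := x)] at h1
    omega
  have hgc : G.dist g c = i + 3 := by
    have h1 := hG.dist_le_add_one g hcv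
    have h2 := hG.dist_le_add_one g hcy
    omega
  have hvp : v ≠ p := by rintro rfl; simp at hpv
  have hvp' : ¬ G.Adj v p := fun h => not_adj_of_two_le_dist hpv.ge h.symm
  obtain ⟨r, hrv, hrp, hr⟩ := hT.quad hvp hvp' hcv hcp hgv hg hgc
  have hrv1 := dist_eq_one_iff_adj.2 hrv
  have hry : G.dist r y = 3 := by
    have h1 := hG.dist_triangle (u := g) (v := r) (w := y)
    have h2 := (hG.dist_le_add_two r h.1).2
    omega
  have hrL : r ∈ G.metricLine u x := by
    rw [← heq, mem_metricLine_of_dist_eq_two h.1]; omega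
  rw [mem_metricLine_of_dist_eq_two h'.1] at hrL
  have h1 := hG.dist_le_add_one r hgu
  have h2 := hG.dist_le_add_one r hgx
  rw [G.dist_comm (u := r) (v := g)] at h1 h2
  have h3 := (hG.dist_le_add_one x hrv).2
  rw [G.dist_comm (u := x) (v := r)] at h3
  have h4 := (hG.dist_le_add_one u hrp).2
  rw [G.dist_comm (u := u) (v := p), G.dist_comm (u := u) (v := r)] at h4
  omega

/-- Two disjoint pairs of parity twins cannot generate the same non-universal line. -/
theorem not_disjoint_parityTwins (hT : G.IsTriangleFull) (htf : G.IsFalseTwinFree)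
    (h : G.ParityTwins v y) (h' : G.ParityTwins u x) (heq : G.metricLine v y = G.metricLine u x)
    (hL : G.metricLine v y ≠ Set.univ) (hvu : v ≠ u) (hvx : v ≠ x) (hyu : y ≠ u) (hyx : y ≠ x) :
    False := by
  have hG := hT.conn
  have hu : u ∈ G.metricLine v y := by
    rw [heq, mem_metricLine_of_dist_eq_two h'.1, dist_self, h'.1]; simp
  have hx : x ∈ G.metricLine v y := by
    rw [heq, mem_metricLine_of_dist_eq_two h'.1, dist_self, dist_comm, h'.1]; simp
  have hv : v ∈ G.metricLine u x := by
    rw [← heq, mem_metricLine_of_dist_eq_two h.1, dist_self, h.1]; simp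
  have hy : y ∈ G.metricLine u x := by
    rw [← heq, mem_metricLine_of_dist_eq_two h.1, dist_self, dist_comm, h.1]; simp
  rw [mem_metricLine_of_dist_eq_two h.1] at hu hx
  rw [mem_metricLine_of_dist_eq_two h'.1, G.dist_comm (u := v), G.dist_comm (u := v)] at hv
  rw [mem_metricLine_of_dist_eq_two h'.1, G.dist_comm (u := y), G.dist_comm (u := y)] at hy
  have p1 := hG.pos_dist_of_ne hvu.symm
  have p2 := hG.pos_dist_of_ne hvx.symm
  have p3 := hG.pos_dist_of_ne hyu.symm
  have p4 := hG.pos_dist_of_ne hyx.symm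
  -- An apex over the edge uv is adjacent to all four vertices by parity, contradicting d(x, y) = 3.
  have mixed : ∀ {v y u x : V}, G.ParityTwins v y → G.ParityTwins u x → G.dist u v = 1 →
      G.dist u y = 1 → G.dist x v = 1 → G.dist x y = 3 → False := by
    clear * - hT hG
    intro v y u x h h' huv huy hxv hxy
    obtain ⟨g, hgu, hgv⟩ := hT.exists_triangle u v (dist_eq_one_iff_adj.1 huv)
    have h1 := (hG.dist_le_add_one g (dist_eq_one_iff_adj.1 hxv)).1
    have h2 := (hG.dist_le_add_one g (dist_eq_one_iff_adj.1 huy)).2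
    rw [dist_eq_one_iff_adj.2 hgv] at h1
    rw [dist_eq_one_iff_adj.2 hgu] at h2
    have h3 := h'.adj_of_dist_le_two hgu h1
    have h4 := h.adj_of_dist_le_two hgv h2
    have h5 := (hG.dist_le_add_one x h4).2
    rw [dist_eq_one_iff_adj.2 h3.symm] at h5
    omega
  -- A common neighbour of u and x is on their line but has distance i + 2 from both v and y.
  have par : ∀ {v y u x : V} {i : ℕ}, G.ParityTwins v y → G.ParityTwins u x →
      G.metricLine v y = G.metricLine u x → G.dist u v = i + 1 → G.dist u y = i + 3 →
      G.dist x v = i + 3 → G.dist x y = i + 1 → False := by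
    clear * - hG
    intro v y u x i h h' heq huv huy hxv hxy
    obtain ⟨c, hcu, hcx⟩ := hG.exists_adj_adj_of_dist_eq_two h'.1
    have hc : c ∈ G.metricLine v y := by
      rw [heq, mem_metricLine_of_dist_eq_two h'.1, dist_eq_one_iff_adj.2 hcu,
        dist_eq_one_iff_adj.2 hcx]; simp
    rw [mem_metricLine_of_dist_eq_two h.1] at hc
    have a1 := hG.dist_le_add_one v hcu
    have a2 := hG.dist_le_add_one v hcx
    have a3 := hG.dist_le_add_one y hcu
    have a4 := hG.dist_le_add_one y hcx
    simp only [G.dist_comm (u := v), G.dist_comm (u := y)] at a1 a2 a3 a4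
    omega
  -- The pairs are completely joined; t is on the line of vy but at distance two from both u and x.
  have priv : ∀ {v y u x t : V}, G.ParityTwins v y → G.ParityTwins u x →
      G.metricLine v y = G.metricLine u x → G.dist u v = 1 → G.dist u y = 1 →
      G.dist x v = 1 → G.dist x y = 1 → G.dist t v = 1 → G.dist t y = 3 → False := by
    clear * - hG
    intro v y u x t h h' heq huv huy hxv hxy htv hty
    have ht : t ∈ G.metricLine u x := by
      rw [← heq, mem_metricLine_of_dist_eq_two h.1]; omega
    rw [mem_metricLine_of_dist_eq_two h'.1] at ht
    have a1 := (hG.dist_le_add_one t (dist_eq_one_iff_adj.1 huv)).1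
    have a2 := (hG.dist_le_add_one t (dist_eq_one_iff_adj.1 hxv)).1
    have a3 := (hG.dist_le_add_one t (dist_eq_one_iff_adj.1 huy)).2
    have a4 := (hG.dist_le_add_one t (dist_eq_one_iff_adj.1 hxy)).2
    omega
  have s1 := metricLine_comm (G := G) v y
  have s2 := metricLine_comm (G := G) u x
  have main : ∀ {v y u x : V}, G.ParityTwins v y → G.ParityTwins u x →
      G.metricLine v y = G.metricLine u x → G.metricLine v y ≠ Set.univ →
      0 < G.dist u v → 0 < G.dist x y → 0 < G.dist x v → G.dist u y = G.dist u v + 2 →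
      (G.dist x v = G.dist x y + 2 ∨ G.dist x y = G.dist x v + 2) →
      (G.dist u v = G.dist x v + 2 ∨ G.dist x v = G.dist u v + 2 ∨
        (G.dist u v = 1 ∧ G.dist x v = 1)) →
      (G.dist u y = G.dist x y + 2 ∨ G.dist x y = G.dist u y + 2 ∨
        (G.dist u y = 1 ∧ G.dist x y = 1)) → False := by
    clear * - hT par
    intro v y u x h h' heq hL q1 q2 q3 hu hx hv hy
    obtain ⟨i, hi⟩ := Nat.exists_eq_add_of_lt q1
    rcases hx with hx | hx
    · exact par (i := i) h h' heq (by omega) (by omega) (by omega) (by omega)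
    · rcases Nat.lt_or_gt_of_ne (show G.dist u v ≠ G.dist x v by omega) with hlt | hlt
      · exact hL (hT.metricLine_eq_univ_of_aligned (i := i) h h' heq (by omega) (by omega)
          (by omega) (by omega))
      · obtain ⟨j, hj⟩ := Nat.exists_eq_add_of_lt q3
        exact hL (hT.metricLine_eq_univ_of_aligned (i := j) h h'.symm
          (heq.trans (metricLine_comm u x)) (by omega) (by omega) (by omega) (by omega))
  rcases hu with hu | hu | hu
  · rcases hx with hx | hx | hx
    · exact main h.symm h' (s1.symm.trans heq) (s1 ▸ hL) p3 p2 p4 (by omega) (by omega) (by omega)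
        (by omega)
    · exact main h.symm h' (s1.symm.trans heq) (s1 ▸ hL) p3 p2 p4 (by omega) (by omega) (by omega)
        (by omega)
    · exact mixed h.symm h'.symm hx.2 hx.1 (by omega) (by omega)
  · rcases hx with hx | hx | hx
    · exact main h h' heq hL p1 p4 p2 (by omega) (by omega) (by omega) (by omega)
    · exact main h h' heq hL p1 p4 p2 (by omega) (by omega) (by omega) (by omega)
    · exact mixed h h'.symm hx.1 hx.2 (by omega) (by omega)
  · rcases hx with hx | hx | hx
    · exact mixed h.symm h' hu.2 hu.1 (by omega) (by omega)
    · exact mixed h h' hu.1 hu.2 (by omega) (by omega)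
    · obtain ⟨t, ht | ht⟩ := h.exists_private hG htf
      · exact priv h h' heq hu.1 hu.2 hx.1 hx.2 ht.1 ht.2
      · exact priv h.symm h' (s1.symm.trans heq) hu.2 hu.1 hx.2 hx.1 ht.1 ht.2

end IsTriangleFull

/-! ### Repeated pairs and stars -/

/-- A pair of parity twins whose line is also generated by another pair of parity twins. -/
def IsRepeated (G : SimpleGraph V) (v y : V) : Prop :=
  G.ParityTwins v y ∧
    ∃ u x, G.ParityTwins u x ∧ G.metricLine u x = G.metricLine v y ∧ s(u, x) ≠ s(v, y)

/-- Two pairs of parity twins with common vertex `v` that generate the same non-universal line. -/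
structure IsStar (G : SimpleGraph V) (v y x : V) : Prop where
  left : G.ParityTwins v y
  right : G.ParityTwins v x
  line_eq : G.metricLine v y = G.metricLine v x
  ne_univ : G.metricLine v y ≠ Set.univ
  ne : y ≠ x

theorem IsRepeated.symm {v y : V} (h : G.IsRepeated v y) : G.IsRepeated y v := by
  obtain ⟨h1, u, x, h2, h3, h4⟩ := h
  exact ⟨h1.symm, u, x, h2, h3.trans (metricLine_comm _ _), by rwa [Sym2.eq_swap (a := y)]⟩

theorem IsRepeated.exists_isStar {v y : V} (h : G.IsRepeated v y) (hT : G.IsTriangleFull)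
    (htf : G.IsFalseTwinFree) (hL : G.metricLine v y ≠ Set.univ) :
    (∃ x, G.IsStar v y x) ∨ ∃ x, G.IsStar y v x := by
  obtain ⟨h1, u, x, h2, h3, h4⟩ := h
  have hL' : G.metricLine y v ≠ Set.univ := by rwa [metricLine_comm]
  by_cases e1 : v = u
  · subst e1
    exact Or.inl ⟨x, h1, h2, h3.symm, hL, fun e => h4 (by rw [e])⟩
  by_cases e2 : v = x
  · subst e2
    exact Or.inl ⟨u, h1, h2.symm, h3.symm.trans (metricLine_comm _ _), hL,
      fun e => h4 (by rw [e, Sym2.eq_swap])⟩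
  by_cases e3 : y = u
  · subst e3
    exact Or.inr ⟨x, h1.symm, h2, (metricLine_comm _ _).trans h3.symm, hL',
      fun e => h4 (by rw [e, Sym2.eq_swap])⟩
  by_cases e4 : y = x
  · subst e4
    exact Or.inr ⟨u, h1.symm, h2.symm,
      (metricLine_comm _ _).trans (h3.symm.trans (metricLine_comm _ _)), hL',
      fun e => h4 (by rw [e])⟩
  exact (hT.not_disjoint_parityTwins htf h1 h2 h3.symm hL e1 e2 e3 e4).elim

theorem IsStar.dist_eq_four {v y x : V} (h : G.IsStar v y x) (hG : G.Connected) :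
    G.dist y x = 4 :=
  h.left.dist_eq_four_of_metricLine_eq h.right hG h.line_eq h.ne

/-- Such a z is off the common line, so it is equidistant from v and the other leaf as well. This is
how distances propagate through a star. -/
theorem IsStar.dist_eq_of_dist_eq {v y x z : V} {k : ℕ} (h : G.IsStar v y x) (hG : G.Connected)
    (hv : G.dist z v = k + 2) (hy : G.dist z y = k + 2) : G.dist z x = k + 2 := by
  have hz : z ∉ G.metricLine v x := by
    rw [← h.line_eq, mem_metricLine_of_dist_eq_two h.left.1]; omega
  obtain ⟨j, h1, h2⟩ := h.right.dist_eq_of_notMem hG hz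
  omega

theorem Connected.dist_eq_two_of_adj (hG : G.Connected) {c v w : V} (hv : G.Adj c v)
    (hw : G.Adj c w) (hne : v ≠ w) (hn : ¬ G.Adj v w) : G.dist v w = 2 := by
  have h1 := (hG.dist_le_add_one v hw).2
  rw [dist_eq_one_iff_adj.2 hv.symm] at h1
  have h2 := hG.pos_dist_of_ne hne
  rw [← dist_eq_one_iff_adj] at hn
  omega

/-- Two pairs share a vertex, and their other ends are parity twins
generating a line that is not repeated. -/
def SplitBy (G : SimpleGraph V) (e e' : Sym2 V) : Prop :=
  ∃ a p p', e = s(a, p) ∧ e' = s(a, p') ∧ G.ParityTwins p p' ∧ ¬ G.IsRepeated p p'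

namespace IsTriangleFull

variable {v y x v' y' x' b c : V}

/-- The far leaf x has distance 3 from v', y' and b, and x' has distance 3 from v, y and b. Hubs g
of v, x and g' of v', x' come out adjacent, and b roofs the 4-cycle v', v, g, g'. -/
theorem not_isStar_join_isStar (hT : G.IsTriangleFull) (h : G.IsStar v y x)
    (h' : G.IsStar v' y' x') (hvv : G.Adj v v') (hvy : G.Adj v y') (hyv : G.Adj y v')
    (hyy : G.Adj y y') (hbv : G.Adj b v) (hby : G.Adj b y) (hbv' : G.Adj b v')
    (hby' : G.Adj b y') : False := by
  have hG := hT.conn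
  have three : ∀ {v y x a : V}, G.IsStar v y x → G.Adj a v → G.Adj a y → G.dist x a = 3 := by
    clear * - hG
    intro v y x a h hv hy
    have h1 := hG.dist_le_add_one x hv
    have h2 := hG.dist_le_add_one x hy
    have h3 := h.dist_eq_four hG
    have h4 := h.right.1
    rw [dist_comm] at h3 h4
    omega
  have hxv' := three h hvv.symm hyv.symm
  have hxy' := three h hvy.symm hyy.symm
  have hxb := three h hbv hby
  have hx'v := three h' hvv hvy
  have hx'y := three h' hyv hyy
  have hx'b := three h' hbv' hby'
  have hx'x := h.dist_eq_of_dist_eq hG hx'v hx'y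
  obtain ⟨g, hgv, hgx, hg⟩ := h.right.exists_hub hT hx'v hx'x
  have two : ∀ {a : V}, G.dist x a = 3 → G.Adj v a → G.dist g a = 2 := by
    intro a ha hva
    have h1 := (hG.dist_le_add_one g hva).2
    rw [dist_eq_one_iff_adj.2 hgv] at h1
    have h2 := (hG.dist_le_add_one a hgx).2
    rw [G.dist_comm (u := a), G.dist_comm (u := a), ha] at h2
    omega
  have hgv' := two hxv' hvv
  have hgy' := two hxy' hvy
  have hgx' := h'.dist_eq_of_dist_eq hG hgv' hgy'
  obtain ⟨g', hgv2, hgx2, hg'⟩ := h'.right.exists_hub hT hgv' hgx'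
  have hxg := dist_eq_one_iff_adj.2 hgx.symm
  have hxg' := dist_eq_one_iff_adj.2 hgx2.symm
  refine hT.house hvv.symm hgv.symm (dist_eq_one_iff_adj.1 hg') hgv2 ?_ ?_ ?_ ?_ hbv' hbv ?_ ?_
  · exact fun h => not_adj_of_two_le_dist hgv'.ge h.symm
  · exact fun h => hG.not_adj_of_dist hxg' hx'v (by simp) h.symm
  · exact (ne_of_dist_lt hxg hxv' (by simp)).symm
  · exact (ne_of_dist_lt hxg' hx'v (by simp)).symm
  · exact fun h => hG.not_adj_of_dist hxg hxb (by simp) h.symm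
  · exact fun h => hG.not_adj_of_dist hxg' hx'b (by simp) h.symm

/-- A private neighbour of v or y is off the line of v'y', so that line is not universal and v'y'
belongs to a star. The far leaf of this star is equidistant from v and y, at distance 3. -/
theorem metricLine_ne_univ_of_join (hT : G.IsTriangleFull) (htf : G.IsFalseTwinFree)
    (h : G.IsRepeated v y) (h' : G.IsRepeated v' y') (hvv : G.Adj v v') (hvy : G.Adj v y')
    (hyv : G.Adj y v') (hyy : G.Adj y y') : G.metricLine v y ≠ Set.univ := by
  intro hU
  have hG := hT.conn
  have hU' : G.metricLine v' y' ≠ Set.univ := by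
    intro hU'
    have key : ∀ {v y t : V}, G.dist t v = 1 → G.dist t y = 3 → G.Adj v v' → G.Adj v y' →
        G.Adj y v' → G.Adj y y' → False := by
      clear * - h' hU' hG
      intro v y t hv hy h1 h2 h3 h4
      have ht : t ∈ G.metricLine v' y' := by rw [hU']; trivial
      rw [mem_metricLine_of_dist_eq_two h'.1.1] at ht
      have a1 := hG.dist_le_add_one t h1
      have a2 := hG.dist_le_add_one t h2
      have a3 := hG.dist_le_add_one t h3
      have a4 := hG.dist_le_add_one t h4
      omega
    obtain ⟨t, ht | ht⟩ := h.1.exists_private hG htf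
    · exact key ht.1 ht.2 hvv hvy hyv hyy
    · exact key ht.1 ht.2 hyv hyy hvv hvy
  have key : ∀ {v' y' x' : V}, G.IsStar v' y' x' → G.Adj v v' → G.Adj v y' →
        G.Adj y v' → G.Adj y y' → False := by
    clear * - h hU hG
    intro v' y' x' hs h1 h2 h3 h4
    have ht : x' ∈ G.metricLine v y := by rw [hU]; trivial
    rw [mem_metricLine_of_dist_eq_two h.1.1] at ht
    have a1 := hG.dist_le_add_one x' h1
    have a2 := hG.dist_le_add_one x' h2
    have a3 := hG.dist_le_add_one x' h3
    have a4 := hG.dist_le_add_one x' h4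
    have a5 := hs.dist_eq_four hG
    have a6 := hs.right.1
    rw [dist_comm] at a5 a6
    omega
  rcases h'.exists_isStar hT htf hU' with ⟨x', hs⟩ | ⟨x', hs⟩
  · exact key hs hvv hvy hyv hyy
  · exact key hs hvy hvv hyy hyv

/-- Two repeated pairs are not completely joined inside a common neighbourhood. -/
theorem not_isRepeated_join (hT : G.IsTriangleFull) (htf : G.IsFalseTwinFree)
    (h : G.IsRepeated v y) (h' : G.IsRepeated v' y') (hvv : G.Adj v v') (hvy : G.Adj v y')
    (hyv : G.Adj y v') (hyy : G.Adj y y') (hbv : G.Adj b v) (hby : G.Adj b y)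
    (hbv' : G.Adj b v') (hby' : G.Adj b y') : False := by
  have hL := hT.metricLine_ne_univ_of_join htf h h' hvv hvy hyv hyy
  have hL' := hT.metricLine_ne_univ_of_join htf h' h hvv.symm hyv.symm hvy.symm hyy.symm
  rcases h.exists_isStar hT htf hL with ⟨x, hs⟩ | ⟨x, hs⟩ <;>
  rcases h'.exists_isStar hT htf hL' with ⟨x', hs'⟩ | ⟨x', hs'⟩
  · exact hT.not_isStar_join_isStar hs hs' hvv hvy hyv hyy hbv hby hbv' hby'
  · exact hT.not_isStar_join_isStar hs hs' hvy hvv hyy hyv hbv hby hby' hbv'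
  · exact hT.not_isStar_join_isStar hs hs' hyv hyy hvv hvy hby hbv hbv' hby'
  · exact hT.not_isStar_join_isStar hs hs' hyy hyv hvy hvv hby hbv hby' hbv'

/-- The leaves y, y', x, x' are, in this cyclic order, the corners of an induced octagon. -/
theorem not_isStar_of_dist_eq_two (hT : G.IsTriangleFull) (h : G.IsStar v y x)
    (h' : G.IsStar v' y' x') (hyy : G.dist y y' = 2) (hyv : G.dist y v' = 2)
    (hvy : G.dist v y' = 2) (hvv : v = v' ∨ G.dist v v' = 2) : False := by
  have hG := hT.conn
  have h1 : G.dist y' x = 2 := h.dist_eq_of_dist_eq (k := 0) hG (by rwa [dist_comm])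
    (by rwa [dist_comm])
  have h2 : G.dist y x' = 2 := h'.dist_eq_of_dist_eq (k := 0) hG hyv hyy
  have h3 : G.dist v x' = 2 := by
    rcases hvv with rfl | hvv
    · exact h'.right.1
    · exact h'.dist_eq_of_dist_eq (k := 0) hG hvv hvy
  rw [dist_comm] at h2 h3
  have h4 : G.dist x' x = 2 := h.dist_eq_of_dist_eq (k := 0) hG h3 h2
  rw [dist_comm] at h4
  exact not_octagon hG hT.free.2 (h.dist_eq_four hG) (h'.dist_eq_four hG) hyy h1 h4 h2

/-- The octagon has corners y, v, x, x'. -/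
theorem not_isStar_path (hT : G.IsTriangleFull) (h : G.IsStar v y x)
    (h' : G.IsStar v' v x') (hyv : G.dist y v' = 2) : False := by
  have hG := hT.conn
  have hvv := h'.left.1
  have hvy := h.left.1
  have h1 : G.dist v' x = 2 := h.dist_eq_of_dist_eq (k := 0) hG hvv (by rwa [dist_comm])
  have h2 : G.dist y x' = 2 :=
    h'.dist_eq_of_dist_eq (k := 0) hG hyv (by rwa [dist_comm])
  have h3 := h'.dist_eq_four hG
  have h4 : x' ∈ G.metricLine v x := by
    rw [← h.line_eq, mem_metricLine_of_dist_eq_two hvy, G.dist_comm (u := x') (v := v), h3,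
      G.dist_comm, h2]
    simp
  rw [mem_metricLine_of_dist_eq_two h.right.1, G.dist_comm (u := x') (v := v), h3] at h4
  have h5 := hG.dist_triangle (u := x') (v := v') (w := x)
  rw [G.dist_comm (u := x') (v := v'), h'.right.1, h1] at h5
  have h6 : G.dist x x' = 2 := by rw [dist_comm]; omega
  rw [dist_comm] at h2 hvy
  exact not_octagon hG hT.free.2 (h.dist_eq_four hG) h3 hvy h.right.1 h6 h2

theorem not_isRepeated_of_isStar (hT : G.IsTriangleFull) (htf : G.IsFalseTwinFree)
    (h : G.IsStar v y x) (h' : G.IsStar v' y x') (hvv : G.dist v v' = 2) :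
    G.ParityTwins v v' ∧ ¬ G.IsRepeated v v' := by
  have hG := hT.conn
  have hyv : G.dist y v = 2 := by rw [dist_comm]; exact h.left.1
  have hyv' : G.dist y v' = 2 := by rw [dist_comm]; exact h'.left.1
  have hvv' : G.dist v' v = 2 := by rwa [dist_comm]
  refine ⟨⟨hvv, fun z => ?_⟩, fun hr => ?_⟩
  · have h1 := h.left.2 z
    have h2 := h'.left.2 z
    omega
  · have hL : G.metricLine v v' ≠ Set.univ := by
      rw [Set.ne_univ_iff_exists_notMem]
      refine ⟨y, ?_⟩
      rw [mem_metricLine_of_dist_eq_two hvv, hyv, hyv']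
      simp
    rcases hr.exists_isStar hT htf hL with ⟨w, hs⟩ | ⟨w, hs⟩
    · exact hT.not_isStar_of_dist_eq_two h hs hyv' hyv hvv (Or.inl rfl)
    · exact hT.not_isStar_of_dist_eq_two h' hs hyv hyv' hvv' (Or.inl rfl)

/-- All distinct vertices of the two pairs are at distance two, and the octagon excludes every
coincidence except y = y'. Then v and v' are parity twins through y, and a star on the pair vv'
would again give an octagon. -/
theorem splitBy_of_isStar (hT : G.IsTriangleFull) (htf : G.IsFalseTwinFree)
    (h : G.IsStar v y x) (h' : G.IsStar v' y' x') (hcv : G.Adj c v) (hcy : G.Adj c y)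
    (hcv' : G.Adj c v') (hcy' : G.Adj c y') (hvv : ¬ G.Adj v v') (hvy : ¬ G.Adj v y')
    (hyv : ¬ G.Adj y v') (hyy : ¬ G.Adj y y') (hne : s(v, y) ≠ s(v', y')) :
    SplitBy G s(v, y) s(v', y') := by
  have hG := hT.conn
  have dvv := fun hne => hG.dist_eq_two_of_adj hcv hcv' hne hvv
  have dvy := fun hne => hG.dist_eq_two_of_adj hcv hcy' hne hvy
  have dyv := fun hne => hG.dist_eq_two_of_adj hcy hcv' hne hyv
  have dyy := fun hne => hG.dist_eq_two_of_adj hcy hcy' hne hyy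
  by_cases e1 : v = v'
  · subst e1
    have e2 : y ≠ y' := fun e => hne (by rw [e])
    exact (hT.not_isStar_of_dist_eq_two h h' (dyy e2) (by rw [dist_comm]; exact h.left.1)
      h'.left.1 (Or.inl rfl)).elim
  by_cases e2 : v = y'
  · subst e2
    have e3 : y ≠ v' := fun e => hne (by rw [e, Sym2.eq_swap])
    exact (hT.not_isStar_path h h' (dyv e3)).elim
  by_cases e3 : y = v'
  · subst e3
    exact (hT.not_isStar_path h' h (by rw [dist_comm]; exact dvy e2)).elim
  by_cases e4 : y = y'
  · subst e4
    obtain ⟨h1, h2⟩ := hT.not_isRepeated_of_isStar htf h h' (dvv e1)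
    exact ⟨y, v, v', Sym2.eq_swap, Sym2.eq_swap, h1, h2⟩
  exact (hT.not_isStar_of_dist_eq_two h h' (dyy e4) (dyv e3) (dvy e2) (Or.inr (dvv e1))).elim

theorem metricLine_ne_univ_of_common_adj (hT : G.IsTriangleFull) (h : G.ParityTwins v y)
    (h' : G.ParityTwins v' y') (hcv : G.Adj c v) (hcy : G.Adj c y)
    (hcv' : G.Adj c v') (hcy' : G.Adj c y') (hvv : ¬ G.Adj v v') (hvy : ¬ G.Adj v y')
    (hyv : ¬ G.Adj y v') (hyy : ¬ G.Adj y y') (hne : s(v, y) ≠ s(v', y')) :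
    G.metricLine v y ≠ Set.univ := by
  intro hU
  have key : ∀ w, G.Adj c w → ¬ G.Adj v w → ¬ G.Adj y w → w = v ∨ w = y := by
    intro w hcw hvw hyw
    by_contra! hno
    have h1 : w ∈ G.metricLine v y := by rw [hU]; trivial
    rw [mem_metricLine_of_dist_eq_two h.1,
      hT.conn.dist_eq_two_of_adj hcw hcv hno.1 (fun h => hvw h.symm),
      hT.conn.dist_eq_two_of_adj hcw hcy hno.2 (fun h => hyw h.symm)] at h1
    omega
  have h3 := h'.ne
  rcases key v' hcv' hvv hyv with rfl | rfl <;> rcases key y' hcy' hvy hyy with rfl | rfl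
  · exact h3 rfl
  · exact hne rfl
  · exact hne Sym2.eq_swap
  · exact h3 rfl

/-- Two distinct repeated pairs in the common neighbourhood of an edge. -/
theorem splitBy_of_common_adj (hT : G.IsTriangleFull) (htf : G.IsFalseTwinFree)
    (h : G.IsRepeated v y) (h' : G.IsRepeated v' y') (hcv : G.Adj c v) (hcy : G.Adj c y)
    (hcv' : G.Adj c v') (hcy' : G.Adj c y') (hne : s(v, y) ≠ s(v', y')) :
    SplitBy G s(v, y) s(v', y') := by
  have hG := hT.conn
  have two : ∀ {a b : V}, G.Adj c a → G.Adj c b → G.dist a b ≤ 2 := by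
    intro a b ha hb
    have := (hG.dist_le_add_one a hb).2
    rwa [dist_eq_one_iff_adj.2 ha.symm] at this
  have cross : ∀ {v y v' y' : V}, G.IsRepeated v y → G.IsRepeated v' y' → G.Adj c v → G.Adj c y →
      G.Adj c v' → G.Adj c y' → ¬ G.Adj v v' := by
    intro v y v' y' h h' hcv hcy hcv' hcy' hvv
    have hvy := h'.1.adj_of_dist_le_two hvv (two hcv hcy')
    have hyv := (h.1.adj_of_dist_le_two hvv.symm (two hcv' hcy)).symm
    have hyy := h'.1.adj_of_dist_le_two hyv (two hcy hcy')
    exact hT.not_isRepeated_join htf h h' hvv hvy hyv hyy hcv hcy hcv' hcy'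
  have hvv := cross h h' hcv hcy hcv' hcy'
  have hvy := cross h h'.symm hcv hcy hcy' hcv'
  have hyv := cross h.symm h' hcy hcv hcv' hcy'
  have hyy := cross h.symm h'.symm hcy hcv hcy' hcv'
  have hL := hT.metricLine_ne_univ_of_common_adj h.1 h'.1 hcv hcy hcv' hcy' hvv hvy hyv hyy hne
  have hL' := hT.metricLine_ne_univ_of_common_adj h'.1 h.1 hcv' hcy' hcv hcy
    (fun h => hvv h.symm) (fun h => hyv h.symm) (fun h => hvy h.symm) (fun h => hyy h.symm) hne.symm
  have s1 := Sym2.eq_swap (a := v) (b := y)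
  have s2 := Sym2.eq_swap (a := v') (b := y')
  rcases h.exists_isStar hT htf hL with ⟨x, hs⟩ | ⟨x, hs⟩ <;>
  rcases h'.exists_isStar hT htf hL' with ⟨x', hs'⟩ | ⟨x', hs'⟩
  · exact hT.splitBy_of_isStar htf hs hs' hcv hcy hcv' hcy' hvv hvy hyv hyy hne
  · rw [s2] at hne ⊢
    exact hT.splitBy_of_isStar htf hs hs' hcv hcy hcy' hcv' hvy hvv hyy hyv hne
  · rw [s1] at hne ⊢
    exact hT.splitBy_of_isStar htf hs hs' hcy hcv hcv' hcy' hyv hyy hvv hvy hne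
  · rw [s1, s2] at hne ⊢
    exact hT.splitBy_of_isStar htf hs hs' hcy hcv hcy' hcv' hyy hyv hvy hvv hne

theorem adj_of_metricLine_eq (hT : G.IsTriangleFull) {u v x y a : V} (huv : G.Adj u v)
    (hxy : G.Adj x y) (h : G.metricLine u v = G.metricLine x y) (hau : G.Adj a u)
    (hav : G.Adj a v) : G.Adj a x ∧ G.Adj a y := by
  rcases hT.edgeMatch_of_metricLine_eq huv hxy h with h | h
  · exact h.2.2.2.2 a hau hav
  · exact (h.2.2.2.2 a hau hav).symm

/-- Sides of the triangles over a repeated pair are never base edges: equality of lines would make v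
and y adjacent to both v' and a, hence by parity to y', a complete join of repeated pairs inside the
neighbourhood of a. -/
theorem metricLine_side_ne_base (hT : G.IsTriangleFull) (htf : G.IsFalseTwinFree)
    (h : G.IsRepeated v y) (h' : G.IsRepeated v' y') (hcb : G.Adj c b) (hcv : G.Adj c v)
    (hcy : G.Adj c y) (hbv : G.Adj b v) (hby : G.Adj b y) {a : V}
    (hav' : G.Adj a v') (hay' : G.Adj a y') :
    G.metricLine c b ≠ G.metricLine v' a := by
  intro heq
  obtain ⟨h1, h2⟩ := hT.adj_of_metricLine_eq hcb hav'.symm heq hcv.symm hbv.symm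
  obtain ⟨h3, h4⟩ := hT.adj_of_metricLine_eq hcb hav'.symm heq hcy.symm hby.symm
  have two : ∀ {w : V}, G.Adj w a → G.dist w y' ≤ 2 := by
    intro w hw
    have := (hT.conn.dist_le_add_one w hay').2
    rwa [dist_eq_one_iff_adj.2 hw] at this
  exact hT.not_isRepeated_join htf h h' h1 (h'.1.adj_of_dist_le_two h1 (two h2)) h3
    (h'.1.adj_of_dist_le_two h3 (two h4)) h2.symm h4.symm hav' hay'

end IsTriangleFull

/-! ### Counting lines with a connected graph on V -/

/-- The line generated by an unordered pair. -/
def pairLine (G : SimpleGraph V) : Sym2 V → Set V :=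
  Sym2.lift ⟨G.metricLine, metricLine_comm⟩

/-- The unordered pairs of parity twins. -/
def parityPairs (G : SimpleGraph V) : Set (Sym2 V) :=
  {e | ∃ v y, e = s(v, y) ∧ G.ParityTwins v y}

/-- The unordered repeated pairs. -/
def repeatedPairs (G : SimpleGraph V) : Set (Sym2 V) :=
  {e | ∃ v y, e = s(v, y) ∧ G.IsRepeated v y}

theorem mk_mem_repeatedPairs {v y : V} : s(v, y) ∈ G.repeatedPairs ↔ G.IsRepeated v y := by
  refine ⟨?_, fun h => ⟨v, y, rfl, h⟩⟩
  rintro ⟨u, x, h1, h2⟩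
  rcases Sym2.eq_iff.1 h1 with ⟨rfl, rfl⟩ | ⟨rfl, rfl⟩
  · exact h2
  · exact h2.symm

theorem repeatedPairs_subset : G.repeatedPairs ⊆ G.parityPairs := by
  rintro e ⟨v, y, rfl, h⟩
  exact ⟨v, y, rfl, h.1⟩

theorem mem_repeatedPairs_of_pairLine_eq {e e' : Sym2 V} (he : e ∈ G.parityPairs)
    (he' : e' ∈ G.parityPairs) (hne : e ≠ e') (h : G.pairLine e = G.pairLine e') :
    e ∈ G.repeatedPairs := by
  obtain ⟨v, y, rfl, h1⟩ := he
  obtain ⟨u, x, rfl, h2⟩ := he'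
  exact ⟨v, y, rfl, h1, u, x, h2, h.symm, hne.symm⟩

theorem ncard_parityPairs_diff_le [Finite V] :
    (G.parityPairs \ G.repeatedPairs).ncard ≤ (G.pairLine '' G.parityPairs).ncard ∧
    (G.repeatedPairs.Nonempty →
      (G.parityPairs \ G.repeatedPairs).ncard + 1 ≤ (G.pairLine '' G.parityPairs).ncard) := by
  have hinj : Set.InjOn G.pairLine (G.parityPairs \ G.repeatedPairs) := by
    intro e he e' he' h
    by_contra hne
    exact he.2 (mem_repeatedPairs_of_pairLine_eq he.1 he'.1 hne h)
  have hsub := Set.image_mono (f := G.pairLine) (Set.sdiff_subset (s := G.parityPairs)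
    (t := G.repeatedPairs))
  constructor
  · rw [← hinj.ncard_image]
    exact Set.ncard_le_ncard hsub (Set.toFinite _)
  · rintro ⟨e, he⟩
    have hnot : G.pairLine e ∉ G.pairLine '' (G.parityPairs \ G.repeatedPairs) := by
      rintro ⟨e', he', h⟩
      refine he'.2 (mem_repeatedPairs_of_pairLine_eq he'.1 (repeatedPairs_subset he) ?_ h)
      rintro rfl
      exact he'.2 he
    rw [← hinj.ncard_image, ← Set.ncard_insert_of_notMem hnot (Set.toFinite _)]
    refine Set.ncard_le_ncard (Set.insert_subset ?_ hsub) (Set.toFinite _)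
    exact Set.mem_image_of_mem _ (repeatedPairs_subset he)

namespace IsTriangleFull

/-- Once K joins parity twins, joining the ends of one edge of a line joins the ends of every edge
of that line. -/
theorem reachable_of_metricLine_eq (hT : G.IsTriangleFull) {K : SimpleGraph V}
    (hK : ∀ v y, G.ParityTwins v y → K.Reachable v y) {u v x y : V} (huv : G.Adj u v)
    (hxy : G.Adj x y) (h : G.metricLine u v = G.metricLine x y) (hr : K.Reachable x y) :
    K.Reachable u v := by
  have aux : ∀ {u x : V}, (u = x ∨ G.ParityTwins u x) → K.Reachable u x := by
    rintro u x (rfl | h)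
    · exact Reachable.refl _
    · exact hK _ _ h
  rcases hT.edgeMatch_of_metricLine_eq huv hxy h with h | h
  · exact ((aux h.1).trans hr).trans (aux h.2.1).symm
  · exact ((aux h.1).trans hr.symm).trans (aux h.2.1).symm

/-- The lines in `D` are bases of triangles whose other two sides have lines outside `D`. -/
def HasApexes (G : SimpleGraph V) (D : Set (Set V)) : Prop :=
  ∀ L ∈ D, ∃ c b a, G.Adj c b ∧ G.Adj c a ∧ G.Adj b a ∧ L = G.metricLine c b ∧
    G.metricLine c a ∉ D ∧ G.metricLine b a ∉ D

theorem preconnected_of_hasApexes (hT : G.IsTriangleFull) {K : SimpleGraph V} {D : Set (Set V)}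
    (hD : HasApexes G D) (hK : ∀ v y, G.ParityTwins v y → K.Reachable v y)
    (hrep : ∀ u v, G.Adj u v → G.metricLine u v ∉ D →
      ∃ x y, G.Adj x y ∧ G.metricLine u v = G.metricLine x y ∧ K.Reachable x y) :
    K.Preconnected := by
  have h1 : ∀ u v, G.Adj u v → G.metricLine u v ∉ D → K.Reachable u v := by
    intro u v huv h
    obtain ⟨x, y, hxy, heq, hr⟩ := hrep u v huv h
    exact hT.reachable_of_metricLine_eq hK huv hxy heq hr
  have h2 : ∀ u v, G.Adj u v → K.Reachable u v := by
    intro u v huv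
    by_cases h : G.metricLine u v ∈ D
    · obtain ⟨c, b, a, hcb, hca, hba, hL, h3, h4⟩ := hD _ h
      exact hT.reachable_of_metricLine_eq hK huv hcb hL
        ((h1 c a hca h3).trans (h1 b a hba h4).symm)
    · exact h1 u v huv h
  intro u v
  obtain ⟨p⟩ := hT.conn.preconnected u v
  induction p with
  | nil => exact Reachable.refl _
  | cons h _ ih => exact (h2 _ _ h).trans ih

/-- The connected graph consists of the nonrepeated pairs, the pairs in `I`, and one edge per edge
line outside `D`; the bound is |V| ≤ edges + 1. -/
theorem card_le_of_hasApexes [Finite V] (hT : G.IsTriangleFull) {D : Set (Set V)}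
    (hDE : D ⊆ G.pairLine '' G.edgeSet) (hD : HasApexes G D) (I : Set (Sym2 V))
    (hI : ∀ v y, G.IsRepeated v y → s(v, y) ∈ I ∨ ∃ e ∈ I, SplitBy G s(v, y) e) :
    Nat.card V + D.ncard ≤ (G.parityPairs \ G.repeatedPairs).ncard + I.ncard +
      (G.pairLine '' G.edgeSet).ncard + 1 := by
  obtain ⟨R, hRsub, hR⟩ := Set.SurjOn.exists_bijOn_subset
    (Set.surjOn_image G.pairLine {e ∈ G.edgeSet | G.pairLine e ∉ D})
  have himg : G.pairLine '' {e ∈ G.edgeSet | G.pairLine e ∉ D} =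
      (G.pairLine '' G.edgeSet) \ D := by
    ext L
    constructor
    · rintro ⟨e, ⟨he, he'⟩, rfl⟩
      exact ⟨⟨e, he, rfl⟩, he'⟩
    · rintro ⟨⟨e, he, rfl⟩, he'⟩
      exact ⟨e, ⟨he, he'⟩, rfl⟩
  rw [himg] at hR
  have hRcard : R.ncard + D.ncard = (G.pairLine '' G.edgeSet).ncard := by
    rw [← Set.ncard_sdiff_add_ncard_of_subset hDE (Set.toFinite _), ← hR.image_eq,
      hR.injOn.ncard_image]
  set S := (G.parityPairs \ G.repeatedPairs) ∪ I ∪ R with hS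
  have hSadj : ∀ u v, u ≠ v → s(u, v) ∈ S → (fromEdgeSet S).Reachable u v := fun u v hne h =>
    Adj.reachable ((fromEdgeSet_adj S).2 ⟨h, hne⟩)
  have hSK : ∀ u v, s(u, v) ∈ S → (fromEdgeSet S).Reachable u v := by
    intro u v h
    by_cases hne : u = v
    · subst hne; exact Reachable.refl _
    · exact hSadj u v hne h
  have hgood : ∀ v y, G.ParityTwins v y → ¬ G.IsRepeated v y →
      (fromEdgeSet S).Reachable v y := fun v y h1 h2 =>
    hSK v y (Or.inl (Or.inl ⟨⟨v, y, rfl, h1⟩, fun h => h2 (mk_mem_repeatedPairs.1 h)⟩))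
  have hK : ∀ v y, G.ParityTwins v y → (fromEdgeSet S).Reachable v y := by
    intro v y h
    by_cases hr : G.IsRepeated v y
    · rcases hI v y hr with h1 | ⟨e, he, a, p, p', h1, h2, h3, h4⟩
      · exact hSK v y (Or.inl (Or.inr h1))
      -- A repeated pair ap outside `I` is replaced by the pair ap' in `I` and the nonrepeated pair
      -- pp'.
      · have h5 : (fromEdgeSet S).Reachable a p :=
          (hSK a p' (Or.inl (Or.inr (h2 ▸ he)))).trans (hgood p p' h3 h4).symm
        rcases Sym2.eq_iff.1 h1 with ⟨rfl, rfl⟩ | ⟨rfl, rfl⟩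
        · exact h5
        · exact h5.symm
    · exact hgood v y h hr
  have hpre : (fromEdgeSet S).Preconnected := by
    refine hT.preconnected_of_hasApexes hD hK ?_
    intro u v huv hu
    obtain ⟨e, he, heq⟩ := hR.surjOn
      (show G.pairLine s(u, v) ∈ _ from ⟨⟨s(u, v), huv, rfl⟩, hu⟩)
    induction e with
    | _ x y =>
      exact ⟨x, y, (hRsub he).1, heq.symm, hSK x y (Or.inr he)⟩
  have := hT.conn.nonempty
  have hcard := (Connected.mk hpre).card_vert_le_card_edgeSet_add_one
  have h1 : Nat.card (fromEdgeSet S).edgeSet ≤ S.ncard := by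
    rw [Nat.card_coe_set_eq]
    refine Set.ncard_le_ncard ?_ (Set.toFinite _)
    rw [edgeSet_fromEdgeSet]
    exact Set.sdiff_subset
  have h2 : S.ncard ≤ _ := Set.ncard_union_le ((G.parityPairs \ G.repeatedPairs) ∪ I) R
  have h3 := Set.ncard_union_le (G.parityPairs \ G.repeatedPairs) I
  omega

theorem exists_base (hT : G.IsTriangleFull) {e : Sym2 V} (he : e ∈ G.repeatedPairs) :
    ∃ L v y c b, e = s(v, y) ∧ G.IsRepeated v y ∧ G.Adj c b ∧ G.Adj c v ∧ G.Adj c y ∧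
      G.Adj b v ∧ G.Adj b y ∧ L = G.metricLine c b := by
  obtain ⟨v, y, rfl, h⟩ := he
  obtain ⟨c, b, h1, h2, h3, h4, h5⟩ := h.1.exists_adj_hubs hT
  exact ⟨_, v, y, c, b, rfl, h, h1, h2, h3, h4, h5, rfl⟩

theorem card_le_of_repeatedPairs_nonempty [Finite V] (hT : G.IsTriangleFull)
    (htf : G.IsFalseTwinFree) (hne : G.repeatedPairs.Nonempty) :
    Nat.card V ≤ (G.pairLine '' G.parityPairs).ncard + (G.pairLine '' G.edgeSet).ncard := by
  choose! base hbase using fun e (he : e ∈ G.repeatedPairs) => hT.exists_base he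
  -- One repeated pair per base line gives |I| = |D|, so the two terms cancel. The remaining + 1 is
  -- absorbed by the line of a repeated pair.
  obtain ⟨I, hIsub, hI⟩ := Set.SurjOn.exists_bijOn_subset (Set.surjOn_image base G.repeatedPairs)
  have hcard := hT.card_le_of_hasApexes (D := base '' G.repeatedPairs) ?_ ?_ I ?_
  · have h1 := ncard_parityPairs_diff_le (G := G).2 hne
    have h2 := hI.injOn.ncard_image
    rw [hI.image_eq] at h2
    omega
  · rintro L ⟨e, he, rfl⟩
    obtain ⟨v, y, c, b, -, -, h, -, -, -, -, hL⟩ := hbase e he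
    exact ⟨s(c, b), h, hL.symm⟩
  · rintro L ⟨e, he, rfl⟩
    obtain ⟨v, y, c, b, -, hr, hcb, hcv, hcy, hbv, hby, hL⟩ := hbase e he
    have side : ∀ a, G.Adj a v → G.Adj a y → G.metricLine a v ∉ base '' G.repeatedPairs := by
      rintro a hav hay ⟨e', he', heq⟩
      obtain ⟨v', y', c', b', -, hr', hcb', hcv', hcy', hbv', hby', hL'⟩ := hbase e' he'
      refine hT.metricLine_side_ne_base htf hr' hr hcb' hcv' hcy' hbv' hby' hav hay ?_
      rw [← hL', heq, metricLine_comm]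
    exact ⟨c, b, v, hcb, hcv, hbv, hL, side c hcv hcy, side b hbv hby⟩
  · intro v y hr
    obtain ⟨e, he, heq⟩ := hI.surjOn (Set.mem_image_of_mem base (mk_mem_repeatedPairs.2 hr))
    by_cases hev : s(v, y) = e
    · exact Or.inl (hev ▸ he)
    refine Or.inr ⟨e, he, ?_⟩
    obtain ⟨v1, y1, c, b, h1, hr1, hcb, hcv, hcy, hbv, hby, hL⟩ :=
      hbase _ (mk_mem_repeatedPairs.2 hr)
    obtain ⟨v', y', c', b', h1', hr', hcb', hcv', hcy', hbv', hby', hL'⟩ := hbase e (hIsub he)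
    rw [h1, h1'] at hev ⊢
    have hcc : G.metricLine c b = G.metricLine c' b' := by rw [← hL, ← hL', heq]
    exact hT.splitBy_of_common_adj htf hr1 hr'
      (hT.adj_of_metricLine_eq hcb hcb' hcc hcv.symm hbv.symm).1.symm
      (hT.adj_of_metricLine_eq hcb hcb' hcc hcy.symm hby.symm).1.symm hcv' hcy' hev

theorem card_le_of_repeatedPairs_empty [Finite V] [Nontrivial V] (hT : G.IsTriangleFull)
    (he : ∀ v y, ¬ G.IsRepeated v y) :
    Nat.card V ≤ (G.pairLine '' G.parityPairs).ncard + (G.pairLine '' G.edgeSet).ncard := by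
  have hG := hT.conn
  obtain ⟨c⟩ := hG.nonempty
  obtain ⟨b, hcb⟩ := hG.preconnected.exists_adj_of_nontrivial c
  obtain ⟨a, hac, hab⟩ := hT.exists_triangle c b hcb
  have aux : ∀ {c b a : V}, G.Adj c b → G.Adj a c → G.Adj a b →
      G.metricLine c a ≠ G.metricLine c b := by
    intro c b a hcb hac hab h
    have h1 : b ∈ G.metricLine c a := by
      rw [h, mem_metricLine_of_adj hG hcb, dist_self, dist_eq_one_iff_adj.2 hcb.symm]; simp
    rw [mem_metricLine_of_adj hG hac.symm, dist_eq_one_iff_adj.2 hcb.symm,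
      dist_eq_one_iff_adj.2 hab.symm] at h1
    exact h1 rfl
  -- Dropping a single line of a triangle side absorbs the + 1.
  have hcard := hT.card_le_of_hasApexes (D := {G.metricLine c b}) ?_ ?_ ∅ ?_
  · have h1 := ncard_parityPairs_diff_le (G := G).1
    rw [Set.ncard_singleton, Set.ncard_empty] at hcard
    omega
  · rintro L rfl
    exact ⟨s(c, b), hcb, rfl⟩
  · rintro L rfl
    refine ⟨c, b, a, hcb, hac.symm, hab.symm, rfl, aux hcb hac hab, ?_⟩
    rw [metricLine_comm c b]
    exact aux hcb.symm hab hac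
  · intro v y h
    exact (he v y h).elim

/-- A triangle-full house- and hole-free graph without false twins has at least as many
short lines as vertices. -/
theorem card_le_ncard_shortLines [Finite V] [Nontrivial V] (hT : G.IsTriangleFull)
    (htf : G.IsFalseTwinFree) : Nat.card V ≤ G.shortLines.ncard := by
  have h1 : Nat.card V ≤
      (G.pairLine '' G.parityPairs).ncard + (G.pairLine '' G.edgeSet).ncard := by
    by_cases hne : G.repeatedPairs.Nonempty
    · exact hT.card_le_of_repeatedPairs_nonempty htf hne
    · exact hT.card_le_of_repeatedPairs_empty fun v y h => hne ⟨_, mk_mem_repeatedPairs.2 h⟩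
  refine h1.trans ?_
  rw [← Set.ncard_union_eq _ (Set.toFinite _) (Set.toFinite _)]
  · refine Set.ncard_le_ncard (Set.union_subset ?_ ?_) (Set.toFinite _)
    · rintro L ⟨e, ⟨v, y, rfl, h⟩, rfl⟩
      exact ⟨v, y, h.ne, h.1.le, rfl⟩
    · rintro L ⟨e, he, rfl⟩
      induction e with
      | _ x y => exact ⟨x, y, he.ne, by rw [dist_eq_one_iff_adj.2 he]; simp, rfl⟩
  · rw [Set.disjoint_left]
    rintro L ⟨e, ⟨v, y, rfl, h⟩, rfl⟩ ⟨e', he', heq⟩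
    induction e' with
    | _ x z => exact h.metricLine_ne_of_adj hT he' heq.symm

end IsTriangleFull

/-! ### Reduction to graphs without false twins -/

/-- The relation of having the same neighbourhood. -/
def falseTwinSetoid (G : SimpleGraph V) : Setoid V where
  r a b := ∀ z, G.Adj z a ↔ G.Adj z b
  iseqv := ⟨fun _ _ => Iff.rfl, fun h z => (h z).symm, fun h h' z => (h z).trans (h' z)⟩

/-- A chosen representative of the class of false twins of a vertex. -/
noncomputable def twinRep (G : SimpleGraph V) (a : V) : V :=
  (Quotient.mk G.falseTwinSetoid a).out

theorem adj_twinRep_right (a z : V) : G.Adj z (G.twinRep a) ↔ G.Adj z a :=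
  Quotient.mk_out (s := G.falseTwinSetoid) a z

theorem adj_twinRep_left (a z : V) : G.Adj (G.twinRep a) z ↔ G.Adj a z := by
  rw [G.adj_comm, adj_twinRep_right, G.adj_comm]

theorem twinRep_eq_iff {a b : V} :
    G.twinRep a = G.twinRep b ↔ ∀ z, G.Adj z a ↔ G.Adj z b := by
  constructor
  · intro h z
    rw [← adj_twinRep_right a, h, adj_twinRep_right]
  · intro h
    have : Quotient.mk G.falseTwinSetoid a = Quotient.mk G.falseTwinSetoid b := Quotient.sound h
    rw [twinRep, this, twinRep]

theorem twinRep_twinRep (a : V) : G.twinRep (G.twinRep a) = G.twinRep a :=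
  twinRep_eq_iff.2 (adj_twinRep_right a)

theorem Connected.dist_le_of_twinRep_eq (hG : G.Connected) {a b x : V}
    (h : G.twinRep a = G.twinRep b) (hx : x ≠ a) : G.dist x b ≤ G.dist x a := by
  obtain ⟨n, hn⟩ := Nat.exists_eq_add_of_lt (hG.pos_dist_of_ne hx)
  obtain ⟨c, hac, hc⟩ := hG.exists_adj_dist_eq (n := n) (by omega : G.dist x a = n + 1)
  have hcb := (twinRep_eq_iff.1 h c).1 hac.symm
  have := (hG.dist_le_add_one x hcb).2
  omega

theorem Connected.dist_eq_of_twinRep_eq (hG : G.Connected) {a b x : V}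
    (h : G.twinRep a = G.twinRep b) (ha : x ≠ a) (hb : x ≠ b) : G.dist x a = G.dist x b :=
  le_antisymm (hG.dist_le_of_twinRep_eq h.symm hb) (hG.dist_le_of_twinRep_eq h ha)

theorem Connected.dist_eq_two_of_twinRep_eq [Nontrivial V] (hG : G.Connected) {a b : V}
    (h : G.twinRep a = G.twinRep b) (hne : a ≠ b) : G.dist a b = 2 := by
  obtain ⟨c, hac⟩ := hG.preconnected.exists_adj_of_nontrivial a
  refine hG.dist_eq_two_of_adj hac.symm ((twinRep_eq_iff.1 h c).1 hac.symm) hne fun h' => ?_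
  exact G.loopless.irrefl a ((twinRep_eq_iff.1 h a).2 h')

/-- The subgraph induced by the representatives of the classes of false twins. -/
def twinReduction (G : SimpleGraph V) : SimpleGraph (Set.range G.twinRep) :=
  G.induce (Set.range G.twinRep)

/-- The retraction onto the twin reduction. -/
noncomputable def twinHom (G : SimpleGraph V) : G →g G.twinReduction where
  toFun a := ⟨G.twinRep a, a, rfl⟩
  map_rel' {a b} h := by
    change G.Adj (G.twinRep a) (G.twinRep b)
    rwa [adj_twinRep_left, adj_twinRep_right]

theorem twinHom_coe (a : Set.range G.twinRep) : G.twinHom a = a := by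
  obtain ⟨_, b, rfl⟩ := a
  exact Subtype.ext (twinRep_twinRep b)

theorem Connected.twinReduction (hG : G.Connected) : G.twinReduction.Connected := by
  have := hG.nonempty
  have : Nonempty (Set.range G.twinRep) := ⟨⟨_, this.some, rfl⟩⟩
  refine Connected.mk fun a b => ?_
  have h := (hG.preconnected a b).map G.twinHom
  rwa [twinHom_coe, twinHom_coe] at h

theorem Connected.dist_twinReduction (hG : G.Connected) (a b : Set.range G.twinRep) :
    G.twinReduction.dist a b = G.dist a b := by
  apply le_antisymm
  · obtain ⟨p, hp⟩ := hG.exists_walk_length_eq_dist (a : V) b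
    have := dist_le (p.map G.twinHom)
    rwa [Walk.length_map, hp, twinHom_coe, twinHom_coe] at this
  · obtain ⟨p, hp⟩ := hG.twinReduction.exists_walk_length_eq_dist a b
    have := dist_le (p.map (⟨Subtype.val, id⟩ : G.twinReduction →g G))
    rwa [Walk.length_map, hp] at this

theorem IsTriangleFull.twinReduction (hT : G.IsTriangleFull) :
    G.twinReduction.IsTriangleFull where
  conn := hT.conn.twinReduction
  free := by
    have h : G.twinReduction.IsIndContained G := ⟨Embedding.induce _⟩
    exact ⟨fun h' => hT.free.1 (h'.trans h), fun k hk h' => hT.free.2 k hk (h'.trans h)⟩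
  exists_triangle u v huv := by
    obtain ⟨a, hau, hav⟩ := hT.exists_triangle u v huv
    refine ⟨⟨G.twinRep a, a, rfl⟩, ?_, ?_⟩
    · exact (adj_twinRep_left a u).2 hau
    · exact (adj_twinRep_left a v).2 hav

theorem isFalseTwinFree_twinReduction : G.twinReduction.IsFalseTwinFree := by
  intro a b h
  rw [← twinHom_coe a, ← twinHom_coe b]
  refine Subtype.ext (twinRep_eq_iff.2 fun z => ?_)
  have h1 : G.Adj (G.twinRep z) a ↔ G.Adj (G.twinRep z) b := h ⟨G.twinRep z, z, rfl⟩
  rwa [adj_twinRep_left, adj_twinRep_left] at h1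

/-- If a false twin of `v` other than `v` is in `L`, all of them are, including `v`. -/
def RespectsTwins (G : SimpleGraph V) (v : V) (L : Set V) : Prop :=
  ∀ x x', G.twinRep x = v → x ≠ v → G.twinRep x' = v → x ∈ L → x' ∈ L

theorem mem_metricLine_left (u v : V) : u ∈ G.metricLine u v := by
  left
  simp [IsBetween]

theorem mem_metricLine_right (u v : V) : v ∈ G.metricLine u v := by
  left
  simp [IsBetween]

theorem mem_metricLine_congr {p q x x' : V} (hp : G.dist p x = G.dist p x')
    (hq : G.dist q x = G.dist q x') : x ∈ G.metricLine p q ↔ x' ∈ G.metricLine p q := by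
  simp only [metricLine, AreCollinear, IsBetween, Set.mem_ofPred_eq]
  rw [G.dist_comm (u := x), G.dist_comm (u := x'), hp, hq]

theorem Connected.respectsTwins_metricLine (hG : G.Connected) {p q v : V}
    (hp : G.twinRep p = v → p = v) (hq : G.twinRep q = v → q = v) :
    G.RespectsTwins v (G.metricLine p q) := by
  intro x x' hx hxv hx' hmem
  by_cases h1 : x' = p
  · exact h1 ▸ mem_metricLine_left _ _
  by_cases h2 : x' = q
  · exact h2 ▸ mem_metricLine_right _ _
  have h3 : p ≠ x := by rintro rfl; exact hxv (hp hx)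
  have h4 : q ≠ x := by rintro rfl; exact hxv (hq hx)
  have he := hx.trans hx'.symm
  exact (mem_metricLine_congr (hG.dist_eq_of_twinRep_eq he h3 (Ne.symm h1))
    (hG.dist_eq_of_twinRep_eq he h4 (Ne.symm h2))).1 hmem

theorem Connected.exists_dist_eq_two (hG : G.Connected) {v : V} :
    ∀ (n : ℕ) (z : V), G.dist v z = n + 2 → G.twinRep z ≠ G.twinRep v →
      ∃ x, G.twinRep x ≠ G.twinRep v ∧ G.dist v x = 2 := by
  intro n
  induction n with
  | zero => exact fun z hz hne => ⟨z, hne, hz⟩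
  | succ n ih =>
    intro z hz hne
    obtain ⟨y, hzy, hy⟩ := hG.exists_adj_dist_eq hz
    by_cases h : G.twinRep y = G.twinRep v
    · have := dist_eq_one_iff_adj.2 ((twinRep_eq_iff.1 h z).1 hzy).symm
      omega
    · exact ih y hy h

/-- A line singling out one false twin `w` that is not a representative. -/
theorem Connected.exists_shortLine_of_twin [Nontrivial V] (hG : G.Connected)
    (huniv : Set.univ ∉ G.shortLines) {w : V} (hw : G.twinRep w ≠ w) :
    ∃ L ∈ G.shortLines, w ∈ L ∧
      (∀ x, G.twinRep x = G.twinRep w → x ≠ G.twinRep w → x ≠ w → x ∉ L) ∧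
      (∃ x, G.twinRep x = G.twinRep w ∧ x ∉ L) ∧
      ∀ v, v ≠ G.twinRep w → G.RespectsTwins v L := by
  set v := G.twinRep w with hv
  have hvv : G.twinRep v = v := twinRep_twinRep w
  have hvw : G.dist v w = 2 := hG.dist_eq_two_of_twinRep_eq hvv hw
  have notMem : ∀ {p q x : V}, G.dist p q = 2 → G.dist x p = 2 → G.dist x q = 2 →
      x ∉ G.metricLine p q := by
    intro p q x h h1 h2
    rw [mem_metricLine_of_dist_eq_two h, h1, h2]
    simp
  -- If some vertex outside the class is at distance two, its representative z is at distance two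
  -- from the whole class, and the line wz meets the class in w only. Otherwise all vertices outside
  -- the class are adjacent to v and w, and the line vw meets the class in v and w only; not being
  -- universal, it misses a third twin.
  by_cases hA : ∃ x, G.twinRep x ≠ v ∧ G.dist v x = 2
  · obtain ⟨x, hxv, hx⟩ := hA
    set z := G.twinRep x with hz
    have hzz : G.twinRep z = z := twinRep_twinRep x
    have hzC : ∀ c, G.twinRep c = v → G.dist c z = 2 := by
      intro c hc
      have h1 : v ≠ x := by rintro rfl; exact hxv hvv
      have h2 : c ≠ z := by rintro rfl; exact hxv (hzz.symm.trans hc)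
      have h3 := hG.dist_eq_of_twinRep_eq (hc.trans hvv.symm) h2.symm hxv
      rw [dist_comm, h3, dist_comm, ← hG.dist_eq_of_twinRep_eq hzz.symm h1 hxv.symm, hx]
    have hwz := hzC w rfl
    refine ⟨G.metricLine w z, ⟨w, z, ?_, hwz.le, rfl⟩, mem_metricLine_left _ _, ?_, ?_, ?_⟩
    · rintro rfl
      simp at hwz
    · intro c hc _ hcw
      exact notMem hwz (hG.dist_eq_two_of_twinRep_eq hc hcw) (hzC c hc)
    · exact ⟨v, hvv, notMem hwz hvw (hzC v hvv)⟩
    · intro v' hv'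
      refine hG.respectsTwins_metricLine (fun h => (hv' h.symm).elim) fun h => ?_
      rwa [hzz] at h
  · have hB : ∀ z, G.twinRep z ≠ v → G.dist z v = 1 := by
      intro z hz
      have h1 : v ≠ z := by rintro rfl; exact hz hvv
      have h2 := hG.pos_dist_of_ne h1
      rw [dist_comm]
      by_contra h3
      obtain ⟨x, hx⟩ := hG.exists_dist_eq_two (v := v) (G.dist v z - 2) z (by omega)
        (by rwa [hvv])
      rw [hvv] at hx
      exact hA ⟨x, hx⟩
    refine ⟨G.metricLine v w, ⟨v, w, hw, hvw.le, rfl⟩, mem_metricLine_right _ _, ?_, ?_, ?_⟩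
    · intro c hc hcv hcw
      exact notMem hvw (hG.dist_eq_two_of_twinRep_eq (hc.trans hvv.symm) hcv)
        (hG.dist_eq_two_of_twinRep_eq hc hcw)
    · by_contra! hno
      refine huniv ⟨v, w, hw, hvw.le, (Set.eq_univ_of_forall fun z => ?_).symm⟩
      by_cases hz : G.twinRep z = v
      · exact hno z hz
      · have h1 := hB z hz
        have h2 : G.dist z w = 1 := by
          rw [← hG.dist_eq_of_twinRep_eq hvv, h1]
          · rintro rfl; simp at h1
          · rintro rfl; exact hz rfl
        rw [mem_metricLine_of_dist_eq_two hvw]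
        omega
    · intro v' hv'
      exact hG.respectsTwins_metricLine (fun h => (hv' (h.symm.trans hvv)).elim)
        fun h => (hv' h.symm).elim

/-- The lines generated by two representatives at distance at most two. -/
def reducedShortLines (G : SimpleGraph V) : Set (Set V) :=
  {L | ∃ a b : Set.range G.twinRep, a ≠ b ∧ G.dist (a : V) b ≤ 2 ∧ L = G.metricLine a b}

theorem Connected.ncard_shortLines_twinReduction_le [Finite V] (hG : G.Connected) :
    G.twinReduction.shortLines.ncard ≤ G.reducedShortLines.ncard := by
  have h : G.twinReduction.shortLines ⊆
      (fun L : Set V => {z : Set.range G.twinRep | (z : V) ∈ L}) '' G.reducedShortLines := by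
    rintro L ⟨a, b, hne, hd, rfl⟩
    refine ⟨_, ⟨a, b, hne, by rwa [← hG.dist_twinReduction], rfl⟩, ?_⟩
    ext z
    simp only [metricLine, AreCollinear, IsBetween, Set.mem_ofPred_eq, hG.dist_twinReduction]
  exact (Set.ncard_le_ncard h (Set.toFinite _)).trans (Set.ncard_image_le (Set.toFinite _))

/-- The line assigned to a discarded w fails `RespectsTwins` at the class of w only. This separates
it from the lines between representatives and from the lines assigned to other classes; within a
class, w is the only nonrepresentative on it. -/
theorem IsTriangleFull.card_le_ncard_shortLines_of_univ_notMem [Finite V] [Nontrivial V]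
    (hT : G.IsTriangleFull) (huniv : Set.univ ∉ G.shortLines) :
    Nat.card V ≤ G.shortLines.ncard := by
  have hG := hT.conn
  set S := Set.range G.twinRep with hS
  have : Nontrivial S := by
    obtain ⟨a⟩ := hG.nonempty
    obtain ⟨b, hab⟩ := hG.preconnected.exists_adj_of_nontrivial a
    exact ⟨⟨_, _, (G.twinHom.map_adj hab).ne⟩⟩
  have h1 := hT.twinReduction.card_le_ncard_shortLines isFalseTwinFree_twinReduction
  have h2 := h1.trans hG.ncard_shortLines_twinReduction_le
  have hout : ∀ w ∈ Sᶜ, G.twinRep w ≠ w := fun w hw h => hw ⟨w, h⟩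
  choose! f hf hmem hnot hex hresp using
    fun w (hw : w ∈ Sᶜ) => hG.exists_shortLine_of_twin huniv (hout w hw)
  have hfail : ∀ w ∈ Sᶜ, ¬ G.RespectsTwins (G.twinRep w) (f w) := by
    intro w hw h
    obtain ⟨x, hx, hx'⟩ := hex w hw
    exact hx' (h w x rfl (hout w hw).symm hx (hmem w hw))
  have hinj : Set.InjOn f Sᶜ := by
    intro w hw w' hw' h
    by_contra hne
    by_cases hr : G.twinRep w = G.twinRep w'
    · exact hnot w' hw' w hr (hr ▸ (hout w hw).symm) hne (h ▸ hmem w hw)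
    · exact hfail w hw (h ▸ hresp w' hw' _ hr)
  have hdisj : Disjoint G.reducedShortLines (f '' Sᶜ) := by
    rw [Set.disjoint_left]
    rintro L ⟨⟨_, a, rfl⟩, ⟨_, b, rfl⟩, -, -, hL⟩ ⟨w, hw, rfl⟩
    refine hfail w hw (hL ▸ hG.respectsTwins_metricLine (fun h => ?_) fun h => ?_)
    · rwa [twinRep_twinRep] at h
    · rwa [twinRep_twinRep] at h
  have hsub : G.reducedShortLines ∪ f '' Sᶜ ⊆ G.shortLines := by
    refine Set.union_subset ?_ ?_
    · rintro L ⟨a, b, hne, hd, rfl⟩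
      exact ⟨a, b, fun h => hne (Subtype.ext h), hd, rfl⟩
    · rintro L ⟨w, hw, rfl⟩
      exact hf w hw
  have h3 := Set.ncard_le_ncard hsub (Set.toFinite _)
  rw [Set.ncard_union_eq hdisj (Set.toFinite _) (Set.toFinite _), hinj.ncard_image] at h3
  rw [Nat.card_coe_set_eq] at h2
  change S.ncard ≤ _ at h2
  have h4 := Set.ncard_add_ncard_compl S
  omega

/-! ### Conclusion -/

theorem univ_mem_shortLines_of_not_triangle (hG : G.Connected) (hfree : G.IsHouseHoleFree)
    {u v : V} (huv : G.Adj u v) (h : ¬ ∃ a, G.Adj a u ∧ G.Adj a v) :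
    Set.univ ∈ G.shortLines := by
  refine ⟨u, v, huv.ne, by rw [dist_eq_one_iff_adj.2 huv]; simp,
    (Set.eq_univ_of_forall fun z => ?_).symm⟩
  rw [mem_metricLine_of_adj hG huv]
  intro heq
  rcases hz : G.dist z u with _ | k
  · rw [hz] at heq
    exact huv.ne ((hG.dist_eq_zero_iff.1 hz).symm.trans (hG.dist_eq_zero_iff.1 heq.symm))
  · obtain ⟨q, h1, h2, -⟩ := exists_adj_adj_of_triangle hG hfree k huv hz (heq ▸ hz)
    exact h ⟨q, h1, h2⟩

theorem deBruijnErdosTwo_of_isHouseHoleFree [Finite V] [Nontrivial V] (hG : G.Connected)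
    (hfree : G.IsHouseHoleFree) : G.DeBruijnErdosTwo := by
  by_cases huniv : Set.univ ∈ G.shortLines
  · exact Or.inl huniv
  refine Or.inr (IsTriangleFull.card_le_ncard_shortLines_of_univ_notMem ⟨hG, hfree, ?_⟩ huniv)
  intro u v huv
  by_contra h
  exact huniv (univ_mem_shortLines_of_not_triangle hG hfree huv h)

theorem shortLines_subset_metricLines : G.shortLines ⊆ G.metricLines := by
  rintro L ⟨u, v, h, -, hL⟩
  exact ⟨u, v, h, hL⟩

theorem DeBruijnErdosTwo.deBruijnErdos [Finite V] (h : G.DeBruijnErdosTwo) : G.DeBruijnErdos :=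
  h.imp (fun h => shortLines_subset_metricLines h)
    fun h => h.trans (Set.ncard_le_ncard shortLines_subset_metricLines (Set.toFinite _))

end SimpleGraph

theorem theorem1 {V : Type*} [Finite V] [Nontrivial V] (G : SimpleGraph V)
    (hconn : G.Connected) (hfree : G.IsHouseHoleFree) :
    G.DeBruijnErdos ∧ G.DeBruijnErdosTwo := by
  have h := SimpleGraph.deBruijnErdosTwo_of_isHouseHoleFree hconn hfree
  exact ⟨h.deBruijnErdos, h⟩
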